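/- Let $n\in\mathbb N$, $T>0$, $H_0,H_1\in\mathfrak{su}(n)$ (traceless skew-Hermitian matrices), and let $\rho_0,\theta$ be Hermitian $n\times n$ matrices. Let $\mathcal H=L^2([0,T],\mathbb R)$ with its standard inner product $(\cdot,\cdot)_{\mathcal H}$, and for $u\in\mathcal H$ let $\mathrm{End}_{\rho_0}(u)=\rho(T)$, where $\rho$ is the (Carathéodory) solution of $$\dot\rho(t)=[H_0+u(t)H_1,\rho(t)]\ \ (t\in[0,T]),\qquad \rho(0)=\rho_0 .$$ Let $\mathcal O(\rho_0)=\{U\rho_0U^\dagger : U\in SU(n)\}$, with tangent spaces $T_\rho\mathcal O(\rho_0)=\{[\rho,\Omega]:\Omega\in\mathfrak{su}(n)\}$ and the Riemannian metric $$\langle[\rho,\Omega_1],[\rho,\Omega_2]\rangle_\rho=\mathrm{tr}\big((\Omega_1^{\mathfrak p_\rho})^\dagger\,\Omega_2^{\mathfrak p_\rho}\big),$$ where $\Omega^{\mathfrak p_\rho}$ is the component of $\Omega$ in the orthogonal complement $\mathfrak p_\rho$ of $\{\Omega\in\mathfrak{su}(n):[\rho,\Omega]=0\}$ in $\mathfrak{su}(n)$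 for the Hilbert--Schmidt product. Put $J(\rho)=\mathrm{Re}\,\mathrm{tr}(\rho\theta)$ on $\mathcal O(\rho_0)$ and $\mathcal J=J\circ\mathrm{End}_{\rho_0}$ on $\mathcal H$. Let $d\mathrm{End}_{\rho_0}(u):\mathcal H\to T_{\mathrm{End}_{\rho_0}(u)}\mathcal O(\rho_0)$ be the differential of $\mathrm{End}_{\rho_0}$ at $u$, and let $d\mathrm{End}^*_{\rho_0}(u)$ be its adjoint with respect to $(\cdot,\cdot)_{\mathcal H}$ and $\langle\cdot,\cdot\rangle_{\mathrm{End}_{\rho_0}(u)}$, with image $\mathcal I_u\subset\mathcal H$. Assume: (H1) $\rho_0$ and $\theta$ both have simple eigenvalues; (H2) every $u\in\mathcal H$ is regular, i.e. $\mathrm{rank}\,d\mathrm{End}_{\rho_0}(u)=\dim\mathcal O(\rho_0)$. Then $J$ has exactly $M:=n!$ critical points on $\mathcal O(\rho_0)$. Moreover, let $\rho_1,\dots,\rho_M$ be any enumeration of them such that $J(\rho_1)\le\dots\le J(\rho_M)$, let $\mathcal H_i=\{u\in\mathcal H:\mathrm{End}_{\rho_0}(u)=\rho_i\}$, and for $u\in\mathcal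 H_i$ let $$\mathcal A(u)=d\mathrm{End}^*_{\rho_0}(u)\,\nabla^2J(\rho_i)\,d\mathrm{End}_{\rho_0}(u),$$ where $\nabla^2J(\rho_i)$ is the Riemannian Hessian of $J$ at $\rho_i$. Then $\mathcal J$ is of class $C^2$ and $\mathcal A(u)$ is its Hessian at $u$, that is, $D^2\mathcal J(u)(v,w)=(\mathcal A(u)v,w)_{\mathcal H}$ for all $v,w\in\mathcal H$; and (i) for $u\in\mathcal H_1$, $\mathcal A(u)$ restricted to $\mathcal I_u$ is positive definite: $(v,\mathcal A(u)v)_{\mathcal H}>0$ for all $0\ne v\in\mathcal I_u$; (ii) for $u\in\mathcal H_M$, $\mathcal A(u)$ restricted to $\mathcal I_u$ is negative definite: $(v,\mathcal A(u)v)_{\mathcal H}<0$ for all $0\ne v\in\mathcal I_u$; (iii) for $u\in\mathcal H_i$ with $1<i<M$, $\mathcal A(u)$ restricted to $\mathcal I_u$ is indefinite: $(v,\mathcal A(u)v)_{\mathcal H}$ takes both positive and negative values on $\mathcal I_u$. -/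

import Mathlib

open MeasureTheory
open scoped Matrix Matrix.Norms.L2Operator

noncomputable section

namespace QControl

/-- Complex `n × n` matrices. The operator norm is used only to speak of integrals and derivatives
of matrix-valued maps. -/
abbrev Mat (n : ℕ) : Type := Matrix (Fin n) (Fin n) ℂ

/-- The control space `L²([0,T], ℝ)`. -/
abbrev Control (T : ℝ) : Type := Lp ℝ 2 (volume.restrict (Set.Icc (0 : ℝ) T))

/-- Traceless skew-Hermitian matrices, as a real vector space. -/
def su (n : ℕ) : Submodule ℝ (Mat n) where
  carrier := {Ω | Ωᴴ = -Ω ∧ Ω.trace = 0}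
  zero_mem' := by simp
  add_mem' := by
    rintro a b ⟨ha, ha'⟩ ⟨hb, hb'⟩
    exact ⟨by rw [Matrix.conjTranspose_add, ha, hb, neg_add], by
      rw [Matrix.trace_add, ha', hb', add_zero]⟩
  smul_mem' := by
    rintro c a ⟨ha, ha'⟩
    exact ⟨by rw [Matrix.conjTranspose_smul, ha, star_trivial, smul_neg], by
      rw [Matrix.trace_smul, ha', smul_zero]⟩

variable {n : ℕ} {T : ℝ}

/-! ### Geometry of the unitary orbit -/

/-- The unitary orbit of `ρ₀`. -/
def orbit (ρ₀ : Mat n) : Set (Mat n) :=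
  {ρ | ∃ U ∈ Matrix.specialUnitaryGroup (Fin n) ℂ, ρ = U * ρ₀ * Uᴴ}

/-- Tangent space of the orbit at `ρ`: the image of `su n` under `Ω ↦ ρ * Ω - Ω * ρ`. -/
def tangentSpace (ρ : Mat n) : Submodule ℝ (Mat n) :=
  (su n).map (LinearMap.mulLeft ℝ ρ - LinearMap.mulRight ℝ ρ)

/-- The orthogonal complement in `su n`, for the Hilbert-Schmidt product, of the stabilizer algebra
of `ρ`. At `ρ = U * ρ₀ * Uᴴ` it is the conjugate by `U` of the complement at `ρ₀`. -/
def horizontal (ρ : Mat n) : Set (Mat n) :=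
  {Ω₁ | Ω₁ ∈ su n ∧ ∀ Ω₂ ∈ su n, ⁅ρ, Ω₂⁆ = 0 → (Ω₁ᴴ * Ω₂).trace = 0}

/-- For `ξ` tangent at `ρ`, the unique horizontal `Ω` such that `⁅ρ, Ω⁆ = ξ`. -/
def lift (ρ ξ : Mat n) : Mat n :=
  Classical.epsilon fun Ω => Ω ∈ horizontal ρ ∧ ⁅ρ, Ω⁆ = ξ

/-- The invariant Riemannian metric of the orbit. The trace is real for tangent `ξ`, `η`. -/
def metric (ρ ξ η : Mat n) : ℝ := ((lift ρ ξ)ᴴ * lift ρ η).trace.re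

/-- The objective on density matrices. -/
def objective (θ ρ : Mat n) : ℝ := (ρ * θ).trace.re

/-- Critical points of the objective on the orbit: the differential vanishes on the tangent
space. -/
def criticalPoints (ρ₀ θ : Mat n) : Set (Mat n) :=
  {ρ | ρ ∈ orbit ρ₀ ∧ ∀ ξ ∈ tangentSpace ρ, fderiv ℝ (objective θ) ρ ξ = 0}

/-- The Riemannian Hessian of the objective on the orbit, as a quadratic form: the second derivative
along the geodesic `t ↦ exp (-tΩ) * ρ * exp (tΩ)`, `Ω` horizontal, with initial velocity `ξ`. -/
def hessQuad (θ ρ ξ : Mat n) : ℝ :=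
  iteratedDeriv 2 (fun t : ℝ => objective θ
    (NormedSpace.exp (-t • lift ρ ξ) * ρ * NormedSpace.exp (t • lift ρ ξ))) 0

/-- The Riemannian Hessian as a symmetric bilinear form, by polarization. -/
def hessForm (θ ρ ξ η : Mat n) : ℝ :=
  (hessQuad θ ρ (ξ + η) - hessQuad θ ρ ξ - hessQuad θ ρ η) / 2

/-- The Riemannian Hessian as an operator on the tangent space: the unique tangent vector that
represents `hessForm θ ρ ξ` in the metric. -/
def hessOp (θ ρ ξ : Mat n) : Mat n :=
  Classical.epsilon fun ζ => ζ ∈ tangentSpace ρ ∧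
    ∀ η ∈ tangentSpace ρ, metric ρ ζ η = hessForm θ ρ ξ η

/-! ### The control system -/

/-- `ρ` solves on `[0,T]` the controlled Liouville-von Neumann equation with initial value `ρ₀`,
in the Caratheodory sense. -/
def IsTrajectory (H₀ H₁ ρ₀ : Mat n) (u : Control T) (ρ : ℝ → Mat n) : Prop :=
  ContinuousOn ρ (Set.Icc 0 T) ∧
    ∀ t ∈ Set.Icc 0 T, ρ t = ρ₀ + ∫ s in (0 : ℝ)..t, ⁅H₀ + u s • H₁, ρ s⁆

/-- The end-point map: the value at time `T` of the trajectory of `u`. -/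
def endMap (H₀ H₁ ρ₀ : Mat n) (u : Control T) : Mat n :=
  Classical.epsilon (IsTrajectory H₀ H₁ ρ₀ u) T

/-- The differential of the end-point map. -/
def dEnd (H₀ H₁ ρ₀ : Mat n) (u : Control T) : Control T →L[ℝ] Mat n :=
  fderiv ℝ (endMap H₀ H₁ ρ₀) u

/-- The adjoint of the differential of the end-point map, for the Riemannian metric at the end
point and the `L²` inner product. -/
def dEndAdj (H₀ H₁ ρ₀ : Mat n) (u : Control T) (ζ : Mat n) : Control T :=
  Classical.epsilon fun w =>
    ∀ v : Control T, metric (endMap H₀ H₁ ρ₀ u) ζ (dEnd H₀ H₁ ρ₀ u v) = inner ℝ w v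

/-- The image of the adjoint, which is defined on the tangent space at the end point. -/
def adjImage (H₀ H₁ ρ₀ : Mat n) (u : Control T) : Set (Control T) :=
  dEndAdj H₀ H₁ ρ₀ u '' (tangentSpace (endMap H₀ H₁ ρ₀ u) : Set (Mat n))

/-- A control is regular if the rank of the differential of the end-point map is the dimension of
the orbit. -/
def IsRegular (H₀ H₁ ρ₀ : Mat n) (u : Control T) : Prop :=
  Module.finrank ℝ (LinearMap.range (dEnd H₀ H₁ ρ₀ u : Control T →ₗ[ℝ] Mat n)) =
    Module.finrank ℝ (tangentSpace ρ₀)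

/-- The objective on controls. -/
def cost (H₀ H₁ ρ₀ θ : Mat n) (u : Control T) : ℝ := objective θ (endMap H₀ H₁ ρ₀ u)

/-- The operator `dEnd* ∘ ∇²J ∘ dEnd` at `u`, with `∇²J` taken at the end point of `u`. -/
def hessianA (H₀ H₁ ρ₀ θ : Mat n) (u v : Control T) : Control T :=
  dEndAdj H₀ H₁ ρ₀ u (hessOp θ (endMap H₀ H₁ ρ₀ u) (dEnd H₀ H₁ ρ₀ u v))

end QControl

end

/-!
The state equation is a linear Volterra equation `x - L_u x = x(0)`, where `L_u` is affine in the
control `u` and its powers are bounded by those of the exponential series. Hence `1 - L_u` is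
invertible and the end-point map is smooth in `u`. It equals `X ρ₀ X†` with `X` the unitary
propagator, so its differential has the form `⁅ρ, K⁆` with `ρ` the end point and `K`
skew-Hermitian.

The critical points are the points of the orbit that commute with `θ`. In an eigenbasis of `θ`,
where `θ = diag b`, they are the diagonal matrices `diag a` whose entries are a permutation of the
spectrum of `ρ₀`. At such a point `ρ` the second derivative of the cost and the Riemannian Hessian
are both given by `(K, L) ↦ Re tr(⁅⁅ρ, K⁆, L⁆ θ)`, whose value at `K = L` is
`-∑ i j, (a i - a j) * (b i - b j) * |L i j|²`. This form is positive definite exactly when `a` and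
`b` are oppositely ordered, and negative definite exactly when they are similarly ordered; by the
rearrangement inequality these are the minimum and the maximum of the objective. Otherwise two
indices ordered the same way and two ordered oppositely give both signs on the tangent space, and at
a regular control the image of the adjoint is mapped onto the tangent space, so both signs
occur there as well.
-/

noncomputable section

namespace QControl

open Set

section Volterra

variable {T : ℝ} {V : Type*} [NormedAddCommGroup V] [NormedSpace ℝ V]

theorem norm_integral_smul_sq_le {α : Type*} [MeasurableSpace α] {μ : Measure α} {u : α → ℝ}
    {x : α → V} (hu : MemLp u 2 μ) (hx : MemLp x 2 μ) :
    ‖∫ s, u s • x s ∂μ‖ ^ 2 ≤ (∫ s, u s ^ 2 ∂μ) * ∫ s, ‖x s‖ ^ 2 ∂μ := by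
  have holder : ∫ s, ‖u s‖ * ‖x s‖ ∂μ ≤ √(∫ s, u s ^ 2 ∂μ) * √(∫ s, ‖x s‖ ^ 2 ∂μ) := by
    have h := integral_mul_le_Lp_mul_Lq_of_nonneg Real.HolderConjugate.two_two
      (.of_forall fun s => norm_nonneg (u s)) (.of_forall fun s => norm_nonneg (x s))
      (by simpa using hu.norm) (by simpa using hx.norm)
    simpa only [Real.rpow_two, Real.norm_eq_abs, sq_abs, ← Real.sqrt_eq_rpow] using h
  calc ‖∫ s, u s • x s ∂μ‖ ^ 2
      ≤ (√(∫ s, u s ^ 2 ∂μ) * √(∫ s, ‖x s‖ ^ 2 ∂μ)) ^ 2 := by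
        gcongr
        refine (norm_integral_le_integral_norm _).trans (le_of_eq_of_le ?_ holder)
        simp only [norm_smul]
    _ = (∫ s, u s ^ 2 ∂μ) * ∫ s, ‖x s‖ ^ 2 ∂μ := by
        rw [mul_pow, Real.sq_sqrt (integral_nonneg fun s => sq_nonneg _),
          Real.sq_sqrt (integral_nonneg fun s => sq_nonneg _)]

theorem Control.norm_sq_eq_integral (u : Control T) : ‖u‖ ^ 2 = ∫ s in Icc 0 T, u s ^ 2 := by
  rw [← real_inner_self_eq_norm_sq, L2.inner_def]
  refine integral_congr_ae (.of_forall fun s => ?_)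
  simp [sq]

theorem Control.integrableOn_smul (u : Control T) {x : ℝ → V} (hx : Continuous x) :
    IntegrableOn (fun s => u s • x s) (Icc 0 T) :=
  IntegrableOn.smul_continuousOn ((Lp.memLp u).integrable (by norm_num)) hx.continuousOn
    isCompact_Icc

theorem Control.intervalIntegrable_smul (u : Control T) {x : ℝ → V} (hx : Continuous x) {t : ℝ}
    (ht : t ∈ Icc 0 T) : IntervalIntegrable (fun s => u s • x s) volume 0 t := by
  rw [intervalIntegrable_iff_integrableOn_Icc_of_le ht.1]
  exact (u.integrableOn_smul hx).mono_set (Icc_subset_Icc_right ht.2)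

theorem Control.norm_integral_smul_sq_le (u : Control T) {x : ℝ → V} (hx : Continuous x) {t : ℝ}
    (ht : t ∈ Icc 0 T) :
    ‖∫ s in (0 : ℝ)..t, u s • x s‖ ^ 2 ≤ ‖u‖ ^ 2 * ∫ s in (0 : ℝ)..t, ‖x s‖ ^ 2 := by
  have hsub : Ioc 0 t ⊆ Icc 0 T := Ioc_subset_Icc_self.trans (Icc_subset_Icc_right ht.2)
  have hu : MemLp u 2 (volume.restrict (Ioc 0 t)) :=
    (Lp.memLp u).mono_measure (Measure.restrict_mono hsub le_rfl)
  have hx' : MemLp x 2 (volume.restrict (Ioc 0 t)) :=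
    (memLp_two_iff_integrable_sq_norm hx.aestronglyMeasurable).2
      ((hx.norm.pow 2).integrableOn_Ioc)
  simp only [intervalIntegral.integral_of_le ht.1, u.norm_sq_eq_integral]
  refine (QControl.norm_integral_smul_sq_le hu hx').trans ?_
  gcongr ?_ * _
  exact setIntegral_mono_set (Lp.memLp u).integrable_sq (.of_forall fun s => sq_nonneg _)
    hsub.eventuallyLE

theorem integral_norm_sq_IccExtend_le {W : Type*} [NormedAddCommGroup W] (hT : 0 ≤ T)
    (x : C(Icc 0 T, W)) {t : ℝ} (ht : t ∈ Icc 0 T) :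
    ∫ s in (0 : ℝ)..t, ‖IccExtend hT x s‖ ^ 2 ≤ T * ‖x‖ ^ 2 :=
  calc ∫ s in (0 : ℝ)..t, ‖IccExtend hT x s‖ ^ 2
      ≤ ∫ _ in (0 : ℝ)..t, ‖x‖ ^ 2 :=
        intervalIntegral.integral_mono_on ht.1
          ((x.continuous.Icc_extend'.norm.pow 2).intervalIntegrable _ _) (by simp)
          fun s _ => pow_le_pow_left₀ (norm_nonneg _) (x.norm_coe_le_norm _) 2
    _ = t * ‖x‖ ^ 2 := by simp
    _ ≤ T * ‖x‖ ^ 2 := by gcongr; exact ht.2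

theorem integral_congr_of_ae_Icc {f g : ℝ → V} (h : f =ᵐ[volume.restrict (Icc 0 T)] g)
    {t : ℝ} (ht : t ∈ Icc 0 T) : ∫ s in (0 : ℝ)..t, f s = ∫ s in (0 : ℝ)..t, g s := by
  rw [intervalIntegral.integral_of_le ht.1, intervalIntegral.integral_of_le ht.1]
  exact integral_congr_ae (ae_restrict_of_ae_restrict_of_subset
    (Ioc_subset_Icc_self.trans (Icc_subset_Icc_right ht.2)) h)

/-- The primitive `t ↦ ∫₀ᵗ u x` of a continuous path `x` against a control `u`. -/
def primitive (hT : 0 ≤ T) (u : Control T) (x : C(Icc 0 T, V)) : C(Icc 0 T, V) where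
  toFun t := ∫ s in (0 : ℝ)..t, u s • IccExtend hT x s
  continuous_toFun := by
    have h := intervalIntegral.continuousOn_primitive_interval (a := 0) (b := T) (μ := volume)
      (f := fun s => u s • IccExtend hT x s)
      (by rw [uIcc_of_le hT]; exact u.integrableOn_smul x.continuous.Icc_extend')
    rw [uIcc_of_le hT] at h
    exact continuousOn_iff_continuous_domRestrict.1 h

theorem primitive_apply (hT : 0 ≤ T) (u : Control T) (x : C(Icc 0 T, V)) (t : Icc 0 T) :
    primitive hT u x t = ∫ s in (0 : ℝ)..t, u s • IccExtend hT x s :=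
  rfl

theorem norm_primitive_le (hT : 0 ≤ T) (u : Control T) (x : C(Icc 0 T, V)) :
    ‖primitive hT u x‖ ≤ √T * ‖u‖ * ‖x‖ := by
  refine (ContinuousMap.norm_le _ (by positivity)).2 fun t => le_of_sq_le_sq ?_ (by positivity)
  calc ‖primitive hT u x t‖ ^ 2
      ≤ ‖u‖ ^ 2 * ∫ s in (0 : ℝ)..t, ‖IccExtend hT x s‖ ^ 2 :=
        u.norm_integral_smul_sq_le x.continuous.Icc_extend' t.2
    _ ≤ ‖u‖ ^ 2 * (T * ‖x‖ ^ 2) := by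
        gcongr
        exact integral_norm_sq_IccExtend_le hT x t.2
    _ = (√T * ‖u‖ * ‖x‖) ^ 2 := by
        rw [mul_pow, mul_pow, Real.sq_sqrt hT]
        ring

/-- `primitive` as a bounded bilinear map. -/
def volterra (hT : 0 ≤ T) (V : Type*) [NormedAddCommGroup V] [NormedSpace ℝ V] :
    Control T →L[ℝ] C(Icc 0 T, V) →L[ℝ] C(Icc 0 T, V) :=
  LinearMap.mkContinuous₂
    (LinearMap.mk₂ ℝ (primitive hT)
      (fun u v x => by
        ext t
        have hx : Continuous (IccExtend hT x) := x.continuous.Icc_extend'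
        simp only [ContinuousMap.add_apply, primitive_apply]
        rw [← intervalIntegral.integral_add (u.intervalIntegrable_smul hx t.2)
          (v.intervalIntegrable_smul hx t.2)]
        refine integral_congr_of_ae_Icc ?_ t.2
        filter_upwards [Lp.coeFn_add u v] with s hs
        rw [hs, Pi.add_apply, add_smul])
      (fun c u x => by
        ext t
        simp only [ContinuousMap.smul_apply, primitive_apply]
        rw [← intervalIntegral.integral_smul]
        refine integral_congr_of_ae_Icc ?_ t.2
        filter_upwards [Lp.coeFn_smul c u] with s hs
        rw [hs, Pi.smul_apply, smul_assoc])
      (fun u x y => by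
        ext t
        simp only [ContinuousMap.add_apply, primitive_apply]
        rw [← intervalIntegral.integral_add
          (u.intervalIntegrable_smul x.continuous.Icc_extend' t.2)
          (u.intervalIntegrable_smul y.continuous.Icc_extend' t.2)]
        simp [IccExtend, smul_add])
      (fun c u x => by
        ext t
        simp only [ContinuousMap.smul_apply, primitive_apply]
        rw [← intervalIntegral.integral_smul]
        simp [IccExtend, smul_comm c]))
    √T (norm_primitive_le hT)

theorem norm_pow_apply_sq_le_of_volterra (hT : 0 ≤ T) {L : C(Icc 0 T, V) →L[ℝ] C(Icc 0 T, V)}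
    {C : ℝ} (hC : 0 ≤ C)
    (hL : ∀ x t, ‖L x t‖ ^ 2 ≤ C * ∫ s in (0 : ℝ)..t, ‖IccExtend hT x s‖ ^ 2)
    (k : ℕ) (x : C(Icc 0 T, V)) (t : Icc 0 T) :
    ‖(L ^ k) x t‖ ^ 2 ≤ C ^ k * ((t : ℝ) ^ k / k.factorial) * ‖x‖ ^ 2 := by
  induction k generalizing t with
  | zero => simpa using pow_le_pow_left₀ (norm_nonneg _) (x.norm_coe_le_norm t) 2
  | succ k ih =>
    calc ‖(L ^ (k + 1)) x t‖ ^ 2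
        ≤ C * ∫ s in (0 : ℝ)..t, ‖IccExtend hT ((L ^ k) x) s‖ ^ 2 := by
          rw [pow_succ' L]
          exact hL _ t
      _ ≤ C * ∫ s in (0 : ℝ)..t, C ^ k * (s ^ k / k.factorial) * ‖x‖ ^ 2 := by
          gcongr
          refine intervalIntegral.integral_mono_on t.2.1
            ((((L ^ k) x).continuous.Icc_extend'.norm.pow 2).intervalIntegrable _ _)
            (Continuous.intervalIntegrable (by fun_prop) _ _) fun s hs => ?_
          have hs' : s ∈ Icc 0 T := ⟨hs.1, hs.2.trans t.2.2⟩
          rw [IccExtend_of_mem _ _ hs']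
          exact ih ⟨s, hs'⟩
      _ = C ^ (k + 1) * ((t : ℝ) ^ (k + 1) / (k + 1).factorial) * ‖x‖ ^ 2 := by
          rw [intervalIntegral.integral_mul_const, intervalIntegral.integral_const_mul,
            intervalIntegral.integral_div, integral_pow, Nat.factorial_succ]
          push_cast
          field_simp
          simp only [sub_zero, ne_eq, Nat.add_eq_zero_iff, one_ne_zero, and_false,
            not_false_eq_true, zero_pow]
          ring

theorem isUnit_one_sub_of_isUnit_one_sub_pow {R : Type*} [Ring R] {a : R} {k : ℕ}
    (h : IsUnit (1 - a ^ k)) : IsUnit (1 - a) := by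
  rw [← mul_neg_geom_sum] at h
  have hcomm : Commute (1 - a) (∑ i ∈ Finset.range k, a ^ i) :=
    Commute.sum_right _ _ _ fun i _ =>
      (Commute.one_left _).sub_left ((Commute.refl a).pow_right i)
  exact (hcomm.isUnit_mul_iff.1 h).1

/-- The operator `x ↦ (t ↦ ∫₀ᵗ (A₀ + u A₁) x)`. -/
def fieldOp (hT : 0 ≤ T) (A₀ A₁ : V →L[ℝ] V) (u : Control T) :
    C(Icc 0 T, V) →L[ℝ] C(Icc 0 T, V) :=
  volterra hT V (Lp.const 2 _ 1) ∘L A₀.compLeftContinuous ℝ (Icc 0 T) +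
    volterra hT V u ∘L A₁.compLeftContinuous ℝ (Icc 0 T)

theorem fieldOp_apply (hT : 0 ≤ T) (A₀ A₁ : V →L[ℝ] V) (u : Control T) (x : C(Icc 0 T, V))
    (t : Icc 0 T) : fieldOp hT A₀ A₁ u x t =
      ∫ s in (0 : ℝ)..t, (A₀ (IccExtend hT x s) + u s • A₁ (IccExtend hT x s)) := by
  have hx : Continuous (IccExtend hT x) := x.continuous.Icc_extend'
  refine (intervalIntegral.integral_add
    (Control.intervalIntegrable_smul (Lp.const 2 _ 1) (A₀.continuous.comp hx) t.2)
    (u.intervalIntegrable_smul (A₁.continuous.comp hx) t.2)).symm.trans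
    (integral_congr_of_ae_Icc ?_ t.2)
  filter_upwards [Lp.coeFn_const 2 (volume.restrict (Icc 0 T)) (1 : ℝ)] with s hs
  simp only [hs, Function.const_apply, one_smul, Function.comp_apply]

theorem norm_volterra_comp_apply_sq_le (hT : 0 ≤ T) (A : V →L[ℝ] V) (u : Control T)
    (x : C(Icc 0 T, V)) (t : Icc 0 T) :
    ‖volterra hT V u (A.compLeftContinuous ℝ (Icc 0 T) x) t‖ ^ 2 ≤
      (‖u‖ * ‖A‖) ^ 2 * ∫ s in (0 : ℝ)..t, ‖IccExtend hT x s‖ ^ 2 := by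
  have hx : Continuous (IccExtend hT x) := x.continuous.Icc_extend'
  refine (u.norm_integral_smul_sq_le (A.continuous.comp hx) t.2).trans ?_
  rw [mul_pow, mul_assoc, ← intervalIntegral.integral_const_mul (‖A‖ ^ 2)]
  gcongr ?_ * ?_
  refine intervalIntegral.integral_mono_on t.2.1
    (((A.continuous.comp hx).norm.pow 2).intervalIntegrable _ _)
    ((continuous_const.mul (hx.norm.pow 2)).intervalIntegrable _ _) fun s _ => ?_
  rw [← mul_pow]
  exact pow_le_pow_left₀ (norm_nonneg _) (A.le_opNorm _) 2

variable [CompleteSpace V]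

theorem isUnit_one_sub_of_volterra (hT : 0 ≤ T) {L : C(Icc 0 T, V) →L[ℝ] C(Icc 0 T, V)}
    {C : ℝ} (hC : 0 ≤ C)
    (hL : ∀ x t, ‖L x t‖ ^ 2 ≤ C * ∫ s in (0 : ℝ)..t, ‖IccExtend hT x s‖ ^ 2) :
    IsUnit (1 - L) := by
  obtain ⟨k, hk⟩ : ∃ k : ℕ, (C * T) ^ k / k.factorial < (1 / 2) ^ 2 :=
    ((FloorSemiring.tendsto_pow_div_factorial_atTop (C * T)).eventually_lt_const
      (by norm_num)).exists
  refine isUnit_one_sub_of_isUnit_one_sub_pow (k := k) ?_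
  refine isUnit_one_sub_of_norm_lt_one (R := C(Icc 0 T, V) →L[ℝ] C(Icc 0 T, V))
    (lt_of_le_of_lt ?_ one_half_lt_one)
  refine ContinuousLinearMap.opNorm_le_bound _ (by norm_num) fun x => ?_
  refine (ContinuousMap.norm_le _ (by positivity)).2 fun t => le_of_sq_le_sq ?_ (by positivity)
  calc ‖(L ^ k) x t‖ ^ 2
      ≤ C ^ k * ((t : ℝ) ^ k / k.factorial) * ‖x‖ ^ 2 :=
        norm_pow_apply_sq_le_of_volterra hT hC hL k x t
    _ ≤ C ^ k * (T ^ k / k.factorial) * ‖x‖ ^ 2 := by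
        gcongr
        exacts [t.2.1, t.2.2]
    _ = (C * T) ^ k / k.factorial * ‖x‖ ^ 2 := by
        rw [mul_pow]
        ring
    _ ≤ (1 / 2 * ‖x‖) ^ 2 := by
        rw [mul_pow (1 / 2 : ℝ)]
        exact mul_le_mul_of_nonneg_right hk.le (sq_nonneg _)

theorem isUnit_one_sub_fieldOp (hT : 0 ≤ T) (A₀ A₁ : V →L[ℝ] V) (u : Control T) :
    IsUnit (1 - fieldOp hT A₀ A₁ u) := by
  refine isUnit_one_sub_of_volterra hT
    (C := 2 * (‖(Lp.const 2 _ 1 : Control T)‖ * ‖A₀‖) ^ 2 + 2 * (‖u‖ * ‖A₁‖) ^ 2)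
    (by positivity) fun x t => ?_
  have h₀ := norm_volterra_comp_apply_sq_le hT A₀ (Lp.const 2 _ 1) x t
  have h₁ := norm_volterra_comp_apply_sq_le hT A₁ u x t
  have hadd := norm_add_le
    (volterra hT V (Lp.const 2 _ 1) (A₀.compLeftContinuous ℝ (Icc 0 T) x) t)
    (volterra hT V u (A₁.compLeftContinuous ℝ (Icc 0 T) x) t)
  refine (pow_le_pow_left₀ (norm_nonneg _) hadd 2).trans (add_sq_le.trans ?_)
  linarith

/-- The solution of `x = x₀ + ∫ (A₀ + u A₁) x`, by inversion of `1 - fieldOp`, which makes its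
smoothness in `u` apparent. -/
def flow (hT : 0 ≤ T) (A₀ A₁ : V →L[ℝ] V) (x₀ : V) (u : Control T) : C(Icc 0 T, V) :=
  Ring.inverse (1 - fieldOp hT A₀ A₁ u) (ContinuousMap.const _ x₀)

theorem eq_flow_iff (hT : 0 ≤ T) (A₀ A₁ : V →L[ℝ] V) (x₀ : V) (u : Control T)
    (x : C(Icc 0 T, V)) : x = flow hT A₀ A₁ x₀ u ↔ ∀ t : Icc 0 T, x t =
      x₀ + ∫ s in (0 : ℝ)..t, (A₀ (IccExtend hT x s) + u s • A₁ (IccExtend hT x s)) := by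
  have hunit := isUnit_one_sub_fieldOp hT A₀ A₁ u
  have heq : x = flow hT A₀ A₁ x₀ u ↔
      (1 - fieldOp hT A₀ A₁ u) x = ContinuousMap.const _ x₀ := by
    constructor
    · rintro rfl
      exact DFunLike.congr_fun (Ring.mul_inverse_cancel _ hunit) _
    · intro h
      rw [flow, ← h]
      exact (DFunLike.congr_fun (Ring.inverse_mul_cancel _ hunit) x).symm
  rw [heq, ContinuousMap.ext_iff]
  refine forall_congr' fun t => ?_
  rw [← fieldOp_apply]
  exact sub_eq_iff_eq_add

theorem flow_zero (hT : 0 ≤ T) (A₀ A₁ : V →L[ℝ] V) (x₀ : V) (u : Control T) :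
    flow hT A₀ A₁ x₀ u ⟨0, left_mem_Icc.2 hT⟩ = x₀ := by
  simpa using (eq_flow_iff hT A₀ A₁ x₀ u _).1 rfl ⟨0, left_mem_Icc.2 hT⟩

theorem contDiff_flow (hT : 0 ≤ T) (A₀ A₁ : V →L[ℝ] V) (x₀ : V) {k : WithTop ℕ∞} :
    ContDiff ℝ k (flow hT A₀ A₁ x₀) := by
  have hfield : ContDiff ℝ k fun u : Control T => 1 - fieldOp hT A₀ A₁ u :=
    contDiff_const.sub (contDiff_const.add ((volterra hT V).contDiff.clm_comp contDiff_const))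
  have hinverse : ContDiff ℝ k fun u : Control T => Ring.inverse (1 - fieldOp hT A₀ A₁ u) :=
    contDiff_iff_contDiffAt.2 fun u => by
      have h := contDiffAt_ringInverse (n := k) ℝ
        (R := C(Icc 0 T, V) →L[ℝ] C(Icc 0 T, V)) (isUnit_one_sub_fieldOp hT A₀ A₁ u).unit
      exact h.comp u hfield.contDiffAt
  exact hinverse.clm_apply contDiff_const

theorem contDiff_flow_apply (hT : 0 ≤ T) (A₀ A₁ : V →L[ℝ] V) (x₀ : V) (t : Icc 0 T)
    {k : WithTop ℕ∞} : ContDiff ℝ k fun u : Control T => flow hT A₀ A₁ x₀ u t :=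
  (ContinuousMap.evalCLM ℝ t).contDiff.comp (contDiff_flow hT A₀ A₁ x₀)

theorem hasDerivWithinAt_flow (hT : 0 ≤ T) (A₀ A₁ : V →L[ℝ] V) (x₀ : V) {u : Control T}
    {f : ℝ → ℝ} (hf : Continuous f) (hu : u =ᵐ[volume.restrict (Icc 0 T)] f) {t : ℝ}
    (ht : t ∈ Icc 0 T) :
    HasDerivWithinAt (IccExtend hT (flow hT A₀ A₁ x₀ u))
      ((A₀ + f t • A₁) (IccExtend hT (flow hT A₀ A₁ x₀ u) t)) (Icc 0 T) t := by
  set x := IccExtend hT (flow hT A₀ A₁ x₀ u) with hx_def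
  have hx : Continuous x := (flow hT A₀ A₁ x₀ u).continuous.Icc_extend'
  have hg : Continuous fun s => A₀ (x s) + f s • A₁ (x s) := by fun_prop
  have hx_int : ∀ s ∈ Icc 0 T, x s = x₀ + ∫ r in (0 : ℝ)..s, (A₀ (x r) + f r • A₁ (x r)) := by
    intro s hs
    rw [hx_def, IccExtend_of_mem _ _ hs, (eq_flow_iff hT A₀ A₁ x₀ u _).1 rfl ⟨s, hs⟩]
    congr 1
    refine integral_congr_of_ae_Icc ?_ hs
    filter_upwards [hu] with r hr
    rw [hr]
  exact ((hg.integral_hasStrictDerivAt 0 t).hasDerivAt.const_add x₀).hasDerivWithinAt.congr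
    hx_int (hx_int t ht)

end Volterra

section StarAlgebra

variable {T : ℝ} {A : Type*} [NormedRing A] [NormedAlgebra ℝ A]

/-- The commutator `K ↦ L ↦ ⁅K, L⁆` as a continuous bilinear map. -/
def lieCLM (A : Type*) [NormedRing A] [NormedAlgebra ℝ A] : A →L[ℝ] A →L[ℝ] A :=
  ContinuousLinearMap.mul ℝ A - (ContinuousLinearMap.mul ℝ A).flip

theorem lieCLM_apply (K L : A) : lieCLM A K L = ⁅K, L⁆ :=
  rfl

theorem denseRange_toLp (T : ℝ) : DenseRange fun f : BoundedContinuousFunction ℝ ℝ =>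
    (BoundedContinuousFunction.toLp 2 (volume.restrict (Icc 0 T)) ℝ f : Control T) :=
  BoundedContinuousFunction.toLp_denseRange ℝ (volume.restrict (Icc 0 T)) ℝ (by norm_num)

variable [CompleteSpace A]

/-- The solution of the Liouville-von Neumann equation `ρ' = ⁅H₀ + u H₁, ρ⁆`, `ρ(0) = ρ₀`. -/
def lieFlow (hT : 0 ≤ T) (H₀ H₁ ρ₀ : A) (u : Control T) : C(Icc 0 T, A) :=
  flow hT (lieCLM A H₀) (lieCLM A H₁) ρ₀ u

/-- The solution of the Schrödinger equation `X' = (H₀ + u H₁) X`, `X(0) = 1`. -/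
def propagator (hT : 0 ≤ T) (H₀ H₁ : A) (u : Control T) : C(Icc 0 T, A) :=
  flow hT (ContinuousLinearMap.mul ℝ A H₀) (ContinuousLinearMap.mul ℝ A H₁) 1 u

theorem lieFlow_one (hT : 0 ≤ T) (H₀ H₁ : A) (u : Control T) :
    lieFlow hT H₀ H₁ 1 u = ContinuousMap.const _ 1 := by
  refine ((eq_flow_iff hT _ _ 1 u _).2 fun t => ?_).symm
  simp [lieCLM_apply, Ring.lie_def, IccExtend]

variable [StarRing A] [ContinuousStar A] [StarModule ℝ A]

theorem star_propagator_mul_lieFlow_mul_propagator (hT : 0 ≤ T) {H₀ H₁ : A}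
    (hH₀ : H₀ ∈ skewAdjoint A) (hH₁ : H₁ ∈ skewAdjoint A) (ρ₀ : A) (u : Control T) (t : Icc 0 T) :
    star (propagator hT H₀ H₁ u t) * lieFlow hT H₀ H₁ ρ₀ u t * propagator hT H₀ H₁ u t = ρ₀ := by
  have hX : Continuous fun u : Control T => propagator hT H₀ H₁ u t :=
    (contDiff_flow_apply (k := 0) hT _ _ _ t).continuous
  have hρ : Continuous fun u : Control T => lieFlow hT H₀ H₁ ρ₀ u t :=
    (contDiff_flow_apply (k := 0) hT _ _ _ t).continuous
  refine (denseRange_toLp T).induction_on u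
    (isClosed_eq ((hX.star.mul hρ).mul hX) continuous_const) fun f => ?_
  have hf := BoundedContinuousFunction.coeFn_toLp (p := 2) (𝕜 := ℝ) (volume.restrict (Icc 0 T)) f
  set u : Control T := BoundedContinuousFunction.toLp 2 (volume.restrict (Icc 0 T)) ℝ f
  set X := IccExtend hT (propagator hT H₀ H₁ u) with hX_def
  set ρ := IccExtend hT (lieFlow hT H₀ H₁ ρ₀ u) with hρ_def
  have hderiv : ∀ s ∈ Icc 0 T,
      HasDerivWithinAt (fun s => star (X s) * ρ s * X s) 0 (Icc 0 T) s := by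
    intro s hs
    have hskew : star (H₀ + f s • H₁) = -(H₀ + f s • H₁) :=
      (skewAdjoint A).add_mem hH₀ (skewAdjoint.smul_mem (f s) hH₁)
    have hX' : HasDerivWithinAt X ((H₀ + f s • H₁) * X s) (Icc 0 T) s :=
      (hasDerivWithinAt_flow hT _ _ 1 f.continuous hf hs).congr_deriv
        (by simp [hX_def, propagator, add_mul])
    have hρ' : HasDerivWithinAt ρ ((H₀ + f s • H₁) * ρ s - ρ s * (H₀ + f s • H₁)) (Icc 0 T) s :=
      (hasDerivWithinAt_flow hT _ _ ρ₀ f.continuous hf hs).congr_deriv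
        (by rw [← map_smul, ← map_add]; rfl)
    refine ((hX'.star.mul hρ').mul hX').congr_deriv ?_
    simp only [star_mul, hskew, Pi.mul_apply]
    noncomm_ring
  have hconst := constant_of_has_deriv_right_zero
    (fun s hs => (hderiv s hs).continuousWithinAt)
    (fun s hs => (hderiv s ⟨hs.1, hs.2.le⟩).mono_of_mem_nhdsWithin (Icc_mem_nhdsGE_of_mem hs)) t t.2
  simpa [hX_def, hρ_def, IccExtend_left, propagator, lieFlow, flow_zero] using hconst

theorem star_propagator_mul_propagator (hT : 0 ≤ T) {H₀ H₁ : A} (hH₀ : H₀ ∈ skewAdjoint A)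
    (hH₁ : H₁ ∈ skewAdjoint A) (u : Control T) (t : Icc 0 T) :
    star (propagator hT H₀ H₁ u t) * propagator hT H₀ H₁ u t = 1 := by
  simpa [lieFlow_one] using star_propagator_mul_lieFlow_mul_propagator hT hH₀ hH₁ 1 u t

theorem propagator_mem_unitary [IsDedekindFiniteMonoid A] (hT : 0 ≤ T) {H₀ H₁ : A}
    (hH₀ : H₀ ∈ skewAdjoint A) (hH₁ : H₁ ∈ skewAdjoint A) (u : Control T) (t : Icc 0 T) :
    propagator hT H₀ H₁ u t ∈ unitary A :=
  have h := star_propagator_mul_propagator hT hH₀ hH₁ u t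
  ⟨h, mul_eq_one_comm.1 h⟩

theorem lieFlow_eq_conj_propagator [IsDedekindFiniteMonoid A] (hT : 0 ≤ T) {H₀ H₁ : A}
    (hH₀ : H₀ ∈ skewAdjoint A) (hH₁ : H₁ ∈ skewAdjoint A) (ρ₀ : A) (u : Control T) (t : Icc 0 T) :
    lieFlow hT H₀ H₁ ρ₀ u t =
      propagator hT H₀ H₁ u t * ρ₀ * star (propagator hT H₀ H₁ u t) := by
  have h := (propagator_mem_unitary hT hH₀ hH₁ u t).2
  nth_rw 2 [← star_propagator_mul_lieFlow_mul_propagator hT hH₀ hH₁ ρ₀ u t]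
  simp only [← mul_assoc, h, one_mul]
  rw [mul_assoc, h, mul_one]

end StarAlgebra

section UnitaryConjugation

variable {E : Type*} [NormedAddCommGroup E] [NormedSpace ℝ E] {A : Type*} [NormedRing A]
  [NormedAlgebra ℝ A] [StarRing A]

/-- The skew-adjoint form `K` with `dX = -K X` of the differential of a map `X` into the unitary
group; the sign makes `⁅X ρ₀ X†, K⁆` the differential of `X ρ₀ X†`. -/
def unitaryGenerator (X : E → A) (x : E) : E →L[ℝ] A :=
  -((ContinuousLinearMap.mul ℝ A).flip (star (X x)) ∘L fderiv ℝ X x)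

theorem unitaryGenerator_apply (X : E → A) (x v : E) :
    unitaryGenerator X x v = -(fderiv ℝ X x v * star (X x)) :=
  rfl

variable [ContinuousStar A] [StarModule ℝ A]

theorem differentiable_unitaryGenerator {X : E → A} (hX : ContDiff ℝ 2 X) :
    Differentiable ℝ (unitaryGenerator X) := by
  have hstar : Differentiable ℝ fun x => star (X x) := (hX.differentiable (by norm_num)).star
  have hfderiv : Differentiable ℝ (fderiv ℝ X) :=
    (hX.fderiv_right (m := 1) (by norm_num)).differentiable (by norm_num)
  exact (((ContinuousLinearMap.mul ℝ A).flip.differentiable.comp hstar).clm_comp hfderiv).neg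

variable {X : E → A} {x : E}

theorem unitaryGenerator_mem_skewAdjoint (hX : DifferentiableAt ℝ X x)
    (hunit : ∀ y, X y ∈ unitary A) (v : E) : unitaryGenerator X x v ∈ skewAdjoint A := by
  have hconst : fderiv ℝ (X * fun y => star (X y)) x v = 0 := by
    have h : (X * fun y => star (X y)) = fun _ => 1 := funext fun y => (hunit y).2
    rw [h, fderiv_const_apply, zero_apply]
  have hleibniz : X x * star (fderiv ℝ X x v) + fderiv ℝ X x v * star (X x) = 0 := by
    rw [← hconst, (hX.hasFDerivAt.mul' hX.hasFDerivAt.star).fderiv]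
    rfl
  rw [skewAdjoint.mem_iff, unitaryGenerator_apply, star_neg, star_mul, star_star, neg_neg]
  exact neg_eq_of_add_eq_zero_right hleibniz

theorem hasFDerivAt_conj_unitary (hX : DifferentiableAt ℝ X x) (hunit : ∀ y, X y ∈ unitary A)
    (ρ₀ : A) : HasFDerivAt (fun y => X y * ρ₀ * star (X y))
      (lieCLM A (X x * ρ₀ * star (X x)) ∘L unitaryGenerator X x) x := by
  refine ((hX.hasFDerivAt.mul_const' ρ₀).mul' hX.hasFDerivAt.star).congr_fderiv ?_
  ext v
  have hskew : X x * star (fderiv ℝ X x v) = -(fderiv ℝ X x v * star (X x)) := by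
    simpa only [skewAdjoint.mem_iff, unitaryGenerator_apply, star_neg, star_mul, star_star,
      neg_neg, neg_eq_iff_eq_neg] using unitaryGenerator_mem_skewAdjoint hX hunit v
  have hstar : star (fderiv ℝ X x v) = -(star (X x) * (fderiv ℝ X x v * star (X x))) := by
    rw [← mul_neg, ← hskew, ← mul_assoc, (hunit x).1, one_mul]
  have hcancel : star (X x) * (X x * (ρ₀ * star (X x))) = ρ₀ * star (X x) := by
    rw [← mul_assoc, (hunit x).1, one_mul]
  calc X x * ρ₀ * star (fderiv ℝ X x v) + fderiv ℝ X x v * ρ₀ * star (X x)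
      = ⁅X x * ρ₀ * star (X x), -(fderiv ℝ X x v * star (X x))⁆ := by
        simp only [Ring.lie_def, hstar, mul_neg, neg_mul, sub_neg_eq_add, mul_assoc, hcancel]

end UnitaryConjugation

section EndPoint

variable {n : ℕ} {T : ℝ}

/-- The value at time `T` of the propagator. -/
def endPropagator (hT : 0 ≤ T) (H₀ H₁ : Mat n) (u : Control T) : Mat n :=
  propagator hT H₀ H₁ u ⟨T, right_mem_Icc.2 hT⟩

theorem contDiff_endPropagator (hT : 0 ≤ T) (H₀ H₁ : Mat n) {k : WithTop ℕ∞} :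
    ContDiff ℝ k (endPropagator hT H₀ H₁ : Control T → Mat n) :=
  contDiff_flow_apply hT _ _ _ _

theorem isTrajectory_iff (hT : 0 ≤ T) (H₀ H₁ ρ₀ : Mat n) (u : Control T) (ρ : ℝ → Mat n) :
    IsTrajectory H₀ H₁ ρ₀ u ρ ↔ ∀ t : Icc 0 T, ρ t = lieFlow hT H₀ H₁ ρ₀ u t := by
  have integral_eq_iff : ∀ x : C(Icc 0 T, Mat n), (∀ t : Icc 0 T, ρ t = x t) →
      ((∀ t ∈ Icc 0 T, ρ t = ρ₀ + ∫ s in (0 : ℝ)..t, ⁅H₀ + u s • H₁, ρ s⁆) ↔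
        x = lieFlow hT H₀ H₁ ρ₀ u) := by
    intro x hx
    rw [lieFlow, eq_flow_iff, Subtype.forall']
    refine forall_congr' fun t => ?_
    rw [hx t]
    refine Eq.congr_right (congrArg _ (intervalIntegral.integral_congr fun s hs => ?_))
    rw [uIcc_of_le t.2.1] at hs
    have hs' : s ∈ Icc 0 T := ⟨hs.1, hs.2.trans t.2.2⟩
    rw [IccExtend_of_mem _ _ hs', ← hx ⟨s, hs'⟩]
    simp only [← lieCLM_apply, map_add, map_smul, add_apply, smul_apply]
  constructor
  · rintro ⟨hρ, h⟩
    let x : C(Icc 0 T, Mat n) := ⟨fun t => ρ t, continuousOn_iff_continuous_domRestrict.1 hρ⟩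
    exact DFunLike.congr_fun ((integral_eq_iff x fun _ => rfl).1 h)
  · intro h
    refine ⟨continuousOn_iff_continuous_domRestrict.2 ?_, (integral_eq_iff _ h).2 rfl⟩
    rw [show (Icc 0 T).domRestrict ρ = lieFlow hT H₀ H₁ ρ₀ u from funext h]
    exact (lieFlow hT H₀ H₁ ρ₀ u).continuous

theorem endMap_eq_lieFlow (hT : 0 ≤ T) (H₀ H₁ ρ₀ : Mat n) (u : Control T) :
    endMap H₀ H₁ ρ₀ u = lieFlow hT H₀ H₁ ρ₀ u ⟨T, right_mem_Icc.2 hT⟩ := by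
  have hex : ∃ ρ, IsTrajectory H₀ H₁ ρ₀ u ρ :=
    ⟨IccExtend hT (lieFlow hT H₀ H₁ ρ₀ u), (isTrajectory_iff hT H₀ H₁ ρ₀ u _).2 fun t => by simp⟩
  exact (isTrajectory_iff hT H₀ H₁ ρ₀ u _).1 (Classical.epsilon_spec hex)
    ⟨T, right_mem_Icc.2 hT⟩

theorem contDiff_endMap (hT : 0 ≤ T) (H₀ H₁ ρ₀ : Mat n) {k : WithTop ℕ∞} :
    ContDiff ℝ k (endMap H₀ H₁ ρ₀ : Control T → Mat n) := by
  rw [funext (endMap_eq_lieFlow hT H₀ H₁ ρ₀)]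
  exact contDiff_flow_apply hT _ _ _ _

variable {H₀ H₁ : Mat n}

theorem endPropagator_mem_unitary (hT : 0 ≤ T) (hH₀ : H₀ ∈ skewAdjoint (Mat n))
    (hH₁ : H₁ ∈ skewAdjoint (Mat n)) (u : Control T) :
    endPropagator hT H₀ H₁ u ∈ unitary (Mat n) :=
  propagator_mem_unitary hT hH₀ hH₁ u _

theorem endMap_eq_conj_endPropagator (hT : 0 ≤ T) (hH₀ : H₀ ∈ skewAdjoint (Mat n))
    (hH₁ : H₁ ∈ skewAdjoint (Mat n)) (ρ₀ : Mat n) (u : Control T) :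
    endMap H₀ H₁ ρ₀ u = endPropagator hT H₀ H₁ u * ρ₀ * star (endPropagator hT H₀ H₁ u) := by
  rw [endMap_eq_lieFlow hT, lieFlow_eq_conj_propagator hT hH₀ hH₁, endPropagator]

theorem hasFDerivAt_endMap (hT : 0 ≤ T) (hH₀ : H₀ ∈ skewAdjoint (Mat n))
    (hH₁ : H₁ ∈ skewAdjoint (Mat n)) (ρ₀ : Mat n) (u : Control T) :
    HasFDerivAt (endMap H₀ H₁ ρ₀)
      (lieCLM (Mat n) (endMap H₀ H₁ ρ₀ u) ∘L unitaryGenerator (endPropagator hT H₀ H₁) u) u := by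
  rw [funext (endMap_eq_conj_endPropagator hT hH₀ hH₁ ρ₀)]
  exact hasFDerivAt_conj_unitary
    (((contDiff_endPropagator hT H₀ H₁).differentiable one_ne_zero).differentiableAt)
    (endPropagator_mem_unitary hT hH₀ hH₁) ρ₀

theorem dEnd_eq_lie (hT : 0 ≤ T) (hH₀ : H₀ ∈ skewAdjoint (Mat n))
    (hH₁ : H₁ ∈ skewAdjoint (Mat n)) (ρ₀ : Mat n) (u v : Control T) :
    dEnd H₀ H₁ ρ₀ u v =
      ⁅endMap H₀ H₁ ρ₀ u, unitaryGenerator (endPropagator hT H₀ H₁) u v⁆ :=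
  congr($((hasFDerivAt_endMap hT hH₀ hH₁ ρ₀ u).fderiv) v)

theorem generator_endPropagator_mem_skewAdjoint (hT : 0 ≤ T) (hH₀ : H₀ ∈ skewAdjoint (Mat n))
    (hH₁ : H₁ ∈ skewAdjoint (Mat n)) (u v : Control T) :
    unitaryGenerator (endPropagator hT H₀ H₁) u v ∈ skewAdjoint (Mat n) :=
  unitaryGenerator_mem_skewAdjoint
    (((contDiff_endPropagator hT H₀ H₁).differentiable one_ne_zero).differentiableAt)
    (endPropagator_mem_unitary hT hH₀ hH₁) v

end EndPoint

section SecondVariation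

variable {n : ℕ}

/-- `objective θ` as a continuous linear functional. -/
def objectiveCLM (θ : Mat n) : Mat n →L[ℝ] ℝ :=
  (Complex.reLm ∘ₗ (Matrix.traceLinearMap (Fin n) ℝ ℂ) ∘ₗ
    LinearMap.mulRight ℝ θ).toContinuousLinearMap

theorem objectiveCLM_apply (θ ρ : Mat n) : objectiveCLM θ ρ = objective θ ρ :=
  rfl

theorem objective_lie (θ ρ K : Mat n) : objective θ ⁅ρ, K⁆ = objective ⁅θ, ρ⁆ K := by
  simp only [objective, Ring.lie_def, sub_mul, mul_sub, Matrix.trace_sub, mul_assoc]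
  rw [Matrix.trace_mul_comm ρ (K * θ), mul_assoc]

theorem objective_lie_eq_zero {θ ρ : Mat n} (h : Commute ρ θ) (K : Mat n) :
    objective θ ⁅ρ, K⁆ = 0 := by
  rw [objective_lie, commute_iff_lie_eq.1 h.symm, objective, mul_zero, Matrix.trace_zero,
    Complex.zero_re]

/-- The second variation `(K, L) ↦ J ⁅⁅ρ, K⁆, L⁆` of `J = objective θ` at `ρ` along the isospectral
motions generated by `K` and `L`. -/
def secondVariation (θ ρ : Mat n) : Mat n →L[ℝ] Mat n →L[ℝ] ℝ :=
  ContinuousLinearMap.compL ℝ _ _ _ (objectiveCLM θ) ∘L lieCLM (Mat n) ∘L lieCLM (Mat n) ρ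

theorem secondVariation_apply (θ ρ K L : Mat n) :
    secondVariation θ ρ K L = objective θ ⁅⁅ρ, K⁆, L⁆ :=
  rfl

theorem secondVariation_comm {θ ρ : Mat n} (h : Commute ρ θ) (K L : Mat n) :
    secondVariation θ ρ K L = secondVariation θ ρ L K := by
  have jacobi : ⁅⁅ρ, K⁆, L⁆ - ⁅⁅ρ, L⁆, K⁆ = ⁅ρ, ⁅K, L⁆⁆ := by
    simp only [Ring.lie_def]
    noncomm_ring
  rw [← sub_eq_zero]
  exact (map_sub (objectiveCLM θ) _ _).symm.trans
    ((congrArg (objectiveCLM θ) jacobi).trans (objective_lie_eq_zero h _))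

theorem secondVariation_congr {θ ρ K K' L L' : Mat n} (h : Commute ρ θ) (hK : ⁅ρ, K⁆ = ⁅ρ, K'⁆)
    (hL : ⁅ρ, L⁆ = ⁅ρ, L'⁆) : secondVariation θ ρ K L = secondVariation θ ρ K' L' := by
  rw [secondVariation_apply, hK, ← secondVariation_apply, secondVariation_comm h,
    secondVariation_apply, hL, ← secondVariation_apply, secondVariation_comm h]

theorem fderiv_fderiv_objective_comp {E : Type*} [NormedAddCommGroup E] [NormedSpace ℝ E]
    {θ : Mat n} {γ : E → Mat n} {K : E → E →L[ℝ] Mat n}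
    (hγ : ∀ x, HasFDerivAt γ (lieCLM (Mat n) (γ x) ∘L K x) x) {x : E}
    (hK : DifferentiableAt ℝ K x) (hcomm : Commute (γ x) θ) (v w : E) :
    fderiv ℝ (fderiv ℝ fun y => objective θ (γ y)) x v w =
      secondVariation θ (γ x) (K x v) (K x w) := by
  have hfirst : (fderiv ℝ fun y => objective θ (γ y)) =
      fun y => objectiveCLM θ ∘L lieCLM (Mat n) (γ y) ∘L K y :=
    funext fun y => ((objectiveCLM θ).hasFDerivAt.comp y (hγ y)).fderiv
  have hlie : HasFDerivAt (fun y => lieCLM (Mat n) (γ y))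
      (lieCLM (Mat n) ∘L lieCLM (Mat n) (γ x) ∘L K x) x :=
    (lieCLM (Mat n)).hasFDerivAt.comp x (hγ x)
  have hsecond := (hasFDerivAt_const (objectiveCLM θ) x).clm_comp (hlie.clm_comp hK.hasFDerivAt)
  rw [hfirst, hsecond.fderiv]
  trans objective θ (⁅γ x, fderiv ℝ K x v w⁆ + ⁅⁅γ x, K x v⁆, K x w⁆)
  · simp [← objectiveCLM_apply, lieCLM_apply]
  · rw [← objectiveCLM_apply, map_add, objectiveCLM_apply, objective_lie_eq_zero hcomm, zero_add]
    rfl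

theorem hessQuad_eq_secondVariation {θ ρ : Mat n} (h : Commute ρ θ) (ξ : Mat n) :
    hessQuad θ ρ ξ = secondVariation θ ρ (lift ρ ξ) (lift ρ ξ) := by
  set Ω := lift ρ ξ
  let γ (t : ℝ) : Mat n := NormedSpace.exp (-t • Ω) * ρ * NormedSpace.exp (t • Ω)
  have hγ₀ : γ 0 = ρ := by simp [γ]
  have hγ : ∀ t, HasFDerivAt γ
      (lieCLM (Mat n) (γ t) ∘L ContinuousLinearMap.toSpanSingleton ℝ Ω) t := by
    intro t
    have hexp := hasDerivAt_exp_smul_const Ω t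
    have hexp_neg := (hasDerivAt_exp_smul_const' Ω (-t)).scomp t (hasDerivAt_neg t)
    refine ((hexp_neg.mul_const ρ).mul hexp).hasFDerivAt.congr_fderiv ?_
    ext : 1
    simp only [neg_smul, one_smul, neg_mul, mul_assoc, Function.comp_apply, smul_add, smul_neg,
      ContinuousLinearMap.toSpanSingleton_apply, ContinuousLinearMap.comp_apply, lieCLM_apply,
      Ring.lie_def, γ]
    abel
  have hsecond := fderiv_fderiv_objective_comp (θ := θ) hγ (differentiableAt_const _ (x := 0))
    (by rwa [hγ₀]) 1 1
  rw [hγ₀, ContinuousLinearMap.toSpanSingleton_apply, one_smul] at hsecond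
  rw [hessQuad, iteratedDeriv_eq_iteratedFDeriv, iteratedFDeriv_two_apply]
  exact hsecond

end SecondVariation
section Metric

variable {n : ℕ}

theorem mem_tangentSpace {ρ ξ : Mat n} : ξ ∈ tangentSpace ρ ↔ ∃ Ω ∈ su n, ⁅ρ, Ω⁆ = ξ :=
  Iff.rfl

theorem lie_mem_tangentSpace (ρ : Mat n) {K : Mat n} (hK : K ∈ skewAdjoint (Mat n)) :
    ⁅ρ, K⁆ ∈ tangentSpace ρ := by
  have htr : star K.trace = -K.trace := by
    rw [← Matrix.trace_conjTranspose, ← Matrix.star_eq_conjTranspose, skewAdjoint.mem_iff.1 hK,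
      Matrix.trace_neg]
  refine mem_tangentSpace.2 ⟨K - (K.trace / n) • (1 : Mat n), ⟨?_, ?_⟩, ?_⟩
  · rw [Matrix.conjTranspose_sub, Matrix.conjTranspose_smul, ← Matrix.star_eq_conjTranspose K,
      skewAdjoint.mem_iff.1 hK, star_div₀, htr, star_natCast, Matrix.conjTranspose_one, neg_div,
      neg_smul, neg_sub_neg, neg_sub]
  · obtain rfl | hn := eq_or_ne n 0
    · exact Matrix.trace_fin_zero _
    · rw [Matrix.trace_sub, Matrix.trace_smul, Matrix.trace_one, Fintype.card_fin, smul_eq_mul,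
        div_mul_cancel₀ _ (Nat.cast_ne_zero.2 hn), sub_self]
  · simp only [Ring.lie_def, mul_sub, sub_mul, mul_smul_comm, smul_mul_assoc, mul_one, one_mul,
      sub_sub_sub_cancel_right]

/-- The real part of the Hilbert-Schmidt product, a real inner product on matrices. -/
def hsForm (n : ℕ) : LinearMap.BilinForm ℝ (Mat n) :=
  LinearMap.mk₂ ℝ (fun A B => (Aᴴ * B).trace.re)
    (fun A B C => by simp [add_mul]) (fun c A B => by simp)
    (fun A B C => by simp [mul_add]) (fun c A B => by simp)

theorem hsForm_apply (A B : Mat n) : hsForm n A B = (Aᴴ * B).trace.re :=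
  rfl

theorem hsForm_comm (A B : Mat n) : hsForm n A B = hsForm n B A := by
  rw [hsForm_apply, hsForm_apply, ← Complex.conj_re, starRingEnd_apply,
    ← Matrix.trace_conjTranspose, Matrix.conjTranspose_mul, Matrix.conjTranspose_conjTranspose]

open scoped ComplexOrder in
theorem hsForm_self_eq_zero {A : Mat n} : hsForm n A A = 0 ↔ A = 0 := by
  have him := (Complex.le_def.1 (Matrix.posSemidef_conjTranspose_mul_self A).trace_nonneg).2
  rw [← Matrix.trace_conjTranspose_mul_self_eq_zero_iff, Complex.ext_iff, ← him]
  exact (and_iff_left rfl).symm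

theorem trace_conjTranspose_mul_eq_zero_iff {A B : Mat n} (hA : A ∈ skewAdjoint (Mat n))
    (hB : B ∈ skewAdjoint (Mat n)) : (Aᴴ * B).trace = 0 ↔ hsForm n A B = 0 := by
  have him : (Aᴴ * B).trace.im = 0 := by
    rw [← Complex.conj_eq_iff_im, starRingEnd_apply, ← Matrix.trace_conjTranspose,
      Matrix.conjTranspose_mul, Matrix.conjTranspose_conjTranspose,
      ← Matrix.star_eq_conjTranspose, ← Matrix.star_eq_conjTranspose, skewAdjoint.mem_iff.1 hA,
      skewAdjoint.mem_iff.1 hB, neg_mul_comm, Matrix.trace_mul_comm]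
  rw [Complex.ext_iff, him]
  exact and_iff_left rfl

/-- The stabilizer algebra of `ρ` in `su n`. -/
def stabilizer (ρ : Mat n) : Submodule ℝ (Mat n) :=
  su n ⊓ LinearMap.ker (LinearMap.mulLeft ℝ ρ - LinearMap.mulRight ℝ ρ)

theorem mem_stabilizer {ρ Ω : Mat n} : Ω ∈ stabilizer ρ ↔ Ω ∈ su n ∧ ⁅ρ, Ω⁆ = 0 :=
  Iff.rfl

theorem mem_horizontal {ρ Ω : Mat n} :
    Ω ∈ horizontal ρ ↔ Ω ∈ su n ⊓ (hsForm n).orthogonal (stabilizer ρ) := by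
  rw [Submodule.mem_inf, LinearMap.BilinForm.mem_orthogonal_iff]
  refine and_congr_right fun hΩ => ⟨fun h Z hZ => ?_, fun h Z hZ h0 => ?_⟩
  · rw [hsForm_comm]
    exact (trace_conjTranspose_mul_eq_zero_iff hΩ.1 hZ.1.1).1 (h Z hZ.1 hZ.2)
  · rw [trace_conjTranspose_mul_eq_zero_iff hΩ.1 hZ.1, hsForm_comm]
    exact h Z ⟨hZ, h0⟩

theorem exists_horizontal (ρ : Mat n) {Ω : Mat n} (hΩ : Ω ∈ su n) :
    ∃ Ω' ∈ horizontal ρ, ⁅ρ, Ω'⁆ = ⁅ρ, Ω⁆ := by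
  have hcompl : IsCompl (stabilizer ρ) ((hsForm n).orthogonal (stabilizer ρ)) := by
    rw [LinearMap.BilinForm.isCompl_orthogonal_iff_disjoint
      (fun A B h => (hsForm_comm B A).trans h), Submodule.disjoint_def]
    exact fun Z hZ hZ' =>
      hsForm_self_eq_zero.1 (LinearMap.BilinForm.mem_orthogonal_iff.1 hZ' Z hZ)
  obtain ⟨Z, hZ, Ω', hΩ', rfl⟩ := Submodule.mem_sup.1
    (hcompl.sup_eq_top ▸ Submodule.mem_top : Ω ∈ stabilizer ρ ⊔ _)
  refine ⟨Ω', mem_horizontal.2 ⟨((su n).add_mem_iff_right hZ.1).1 hΩ, hΩ'⟩, ?_⟩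
  rw [← lieCLM_apply, ← lieCLM_apply, map_add, lieCLM_apply ρ Z, (mem_stabilizer.1 hZ).2, zero_add]

theorem lift_spec {ρ ξ : Mat n} (hξ : ξ ∈ tangentSpace ρ) :
    lift ρ ξ ∈ horizontal ρ ∧ ⁅ρ, lift ρ ξ⁆ = ξ := by
  obtain ⟨Ω, hΩ, rfl⟩ := mem_tangentSpace.1 hξ
  exact Classical.epsilon_spec (exists_horizontal ρ hΩ)

theorem lift_eq {ρ Ω : Mat n} (hΩ : Ω ∈ horizontal ρ) : lift ρ ⁅ρ, Ω⁆ = Ω := by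
  obtain ⟨hlift, hlie⟩ := lift_spec (mem_tangentSpace.2 ⟨Ω, hΩ.1, rfl⟩)
  have hdiff := Submodule.sub_mem _ (mem_horizontal.1 hlift) (mem_horizontal.1 hΩ)
  have hstab : lift ρ ⁅ρ, Ω⁆ - Ω ∈ stabilizer ρ := by
    refine mem_stabilizer.2 ⟨hdiff.1, ?_⟩
    rw [← lieCLM_apply, map_sub, lieCLM_apply, hlie, lieCLM_apply, sub_self]
  exact sub_eq_zero.1 (hsForm_self_eq_zero.1
    (LinearMap.BilinForm.mem_orthogonal_iff.1 hdiff.2 _ hstab))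

/-- The horizontal lift as a linear map on the tangent space. -/
def liftLin (ρ : Mat n) : tangentSpace ρ →ₗ[ℝ] Mat n where
  toFun ξ := lift ρ ξ
  map_add' ξ η := by
    have hsum := mem_horizontal.2 (Submodule.add_mem _ (mem_horizontal.1 (lift_spec ξ.2).1)
      (mem_horizontal.1 (lift_spec η.2).1))
    rw [← lift_eq hsum, ← lieCLM_apply, map_add, lieCLM_apply, (lift_spec ξ.2).2, lieCLM_apply,
      (lift_spec η.2).2, Submodule.coe_add]
  map_smul' c ξ := by
    have hsmul := mem_horizontal.2
      (Submodule.smul_mem _ c (mem_horizontal.1 (lift_spec ξ.2).1))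
    rw [RingHom.id_apply, ← lift_eq hsmul, ← lieCLM_apply, map_smul, lieCLM_apply,
      (lift_spec ξ.2).2, Submodule.coe_smul]

/-- The invariant Riemannian metric as a bilinear form on the tangent space. -/
def metricForm (ρ : Mat n) : LinearMap.BilinForm ℝ (tangentSpace ρ) :=
  (hsForm n).compl₁₂ (liftLin ρ) (liftLin ρ)

theorem eq_zero_of_metricForm_self_eq_zero {ρ : Mat n} (ξ : tangentSpace ρ)
    (h : metricForm ρ ξ ξ = 0) : ξ = 0 := by
  have hlift : lift ρ ξ = 0 := hsForm_self_eq_zero.1 h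
  rw [← Submodule.coe_eq_zero, ← (lift_spec ξ.2).2, hlift, ← lieCLM_apply, map_zero]

theorem nondegenerate_metricForm (ρ : Mat n) : (metricForm ρ).Nondegenerate := by
  have hrefl : (metricForm ρ).IsRefl := fun ξ η h => (hsForm_comm _ _).trans h
  exact hrefl.nondegenerate_iff_separatingLeft.2 fun ξ h =>
    eq_zero_of_metricForm_self_eq_zero ξ (h ξ)

end Metric

section RiemannianHessian

variable {n : ℕ} {θ ρ : Mat n}

theorem hessForm_eq_secondVariation (h : Commute ρ θ) (ξ η : tangentSpace ρ) :
    hessForm θ ρ ξ η = secondVariation θ ρ (lift ρ ξ) (lift ρ η) := by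
  have hadd : lift ρ (ξ + η) = lift ρ ξ + lift ρ η := map_add (liftLin ρ) ξ η
  simp only [hessForm, hessQuad_eq_secondVariation h, hadd, map_add, add_apply,
    secondVariation_comm h (lift ρ η) (lift ρ ξ)]
  ring

theorem hessForm_lie (h : Commute ρ θ) {K L : Mat n} (hK : K ∈ skewAdjoint (Mat n))
    (hL : L ∈ skewAdjoint (Mat n)) :
    hessForm θ ρ ⁅ρ, K⁆ ⁅ρ, L⁆ = secondVariation θ ρ K L :=
  (hessForm_eq_secondVariation h ⟨_, lie_mem_tangentSpace ρ hK⟩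
    ⟨_, lie_mem_tangentSpace ρ hL⟩).trans
    (secondVariation_congr h (lift_spec (lie_mem_tangentSpace ρ hK)).2
      (lift_spec (lie_mem_tangentSpace ρ hL)).2)

theorem hessOp_spec (h : Commute ρ θ) (ξ : tangentSpace ρ) :
    hessOp θ ρ ξ ∈ tangentSpace ρ ∧
      ∀ η ∈ tangentSpace ρ, metric ρ (hessOp θ ρ ξ) η = hessForm θ ρ ξ η := by
  let φ : Module.Dual ℝ (tangentSpace ρ) :=
    (secondVariation θ ρ (lift ρ ξ) : Mat n →ₗ[ℝ] ℝ) ∘ₗ liftLin ρ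
  let ζ := ((metricForm ρ).toDual (nondegenerate_metricForm ρ)).symm φ
  have hζ : ∀ η : tangentSpace ρ, metric ρ ζ η = hessForm θ ρ ξ η := fun η =>
    (LinearMap.BilinForm.apply_toDual_symm_apply (hB := nondegenerate_metricForm ρ) φ η).trans
      (hessForm_eq_secondVariation h ξ η).symm
  exact Classical.epsilon_spec (p := fun ζ : Mat n => ζ ∈ tangentSpace ρ ∧
    ∀ η ∈ tangentSpace ρ, metric ρ ζ η = hessForm θ ρ ξ η)
    ⟨ζ, ζ.2, fun η hη => hζ ⟨η, hη⟩⟩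

end RiemannianHessian
section Conjugation

theorem map_ring_lie {F A B : Type*} [Ring A] [Ring B] [FunLike F A B] [RingHomClass F A B]
    (φ : F) (x y : A) : φ ⁅x, y⁆ = ⁅φ x, φ y⁆ := by
  simp only [Ring.lie_def, map_sub, map_mul]

variable {n : ℕ}

/-- Conjugation `A ↦ V * A * Vᴴ` by a unitary matrix. -/
abbrev conj (V : Matrix.unitaryGroup (Fin n) ℂ) : Mat n ≃⋆ₐ[ℝ] Mat n :=
  Unitary.conjStarAlgAut ℝ (Mat n) V

variable (V : Matrix.unitaryGroup (Fin n) ℂ)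

theorem trace_conj (A : Mat n) : (conj V A).trace = A.trace := by
  rw [Unitary.conjStarAlgAut_apply, Matrix.trace_mul_comm, ← mul_assoc,
    Unitary.star_mul_self_of_mem V.2, one_mul]

theorem conj_mem_su_iff {Ω : Mat n} : conj V Ω ∈ su n ↔ Ω ∈ su n := by
  refine and_congr ?_ (by rw [trace_conj])
  rw [← Matrix.star_eq_conjTranspose, ← Matrix.star_eq_conjTranspose, ← map_star, ← map_neg]
  exact (conj V).injective.eq_iff

theorem tangentSpace_conj (ρ : Mat n) :
    tangentSpace (conj V ρ) =
      (tangentSpace ρ).map ((conj V).toAlgEquiv.toLinearEquiv : Mat n →ₗ[ℝ] Mat n) := by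
  ext ξ
  simp only [Submodule.mem_map, mem_tangentSpace]
  constructor
  · rintro ⟨Ω, hΩ, rfl⟩
    obtain ⟨Ω, rfl⟩ := (conj V).surjective Ω
    exact ⟨_, ⟨Ω, (conj_mem_su_iff V).1 hΩ, rfl⟩, map_ring_lie (conj V) _ _⟩
  · rintro ⟨_, ⟨Ω, hΩ, rfl⟩, rfl⟩
    exact ⟨conj V Ω, (conj_mem_su_iff V).2 hΩ, (map_ring_lie (conj V) _ _).symm⟩

theorem finrank_tangentSpace_conj (ρ : Mat n) :
    Module.finrank ℝ (tangentSpace (conj V ρ)) = Module.finrank ℝ (tangentSpace ρ) := by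
  rw [tangentSpace_conj]
  exact LinearEquiv.finrank_map_eq _ _

theorem objective_conj (θ ρ : Mat n) : objective (conj V θ) (conj V ρ) = objective θ ρ := by
  rw [objective, ← map_mul, trace_conj, objective]

theorem secondVariation_conj (θ ρ K L : Mat n) :
    secondVariation (conj V θ) (conj V ρ) (conj V K) (conj V L) = secondVariation θ ρ K L := by
  rw [secondVariation_apply, ← map_ring_lie, ← map_ring_lie, objective_conj, secondVariation_apply]

end Conjugation

section Adjoint

/-- The kernel of `D ∘ R` is that of the adjoint `R`, which is trivial. -/
theorem surjective_comp_adjoint {E W : Type*} [NormedAddCommGroup E] [InnerProductSpace ℝ E]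
    [AddCommGroup W] [Module ℝ W] [FiniteDimensional ℝ W] {B : LinearMap.BilinForm ℝ W}
    (hB : B.Nondegenerate) {D : E →ₗ[ℝ] W} (hD : Function.Surjective D) {R : W →ₗ[ℝ] E}
    (hR : ∀ ζ v, B ζ (D v) = inner ℝ (R ζ) v) : Function.Surjective (D ∘ₗ R) := by
  refine LinearMap.injective_iff_surjective.1 ((injective_iff_map_eq_zero (D ∘ₗ R)).2 ?_)
  intro ζ hζ
  have hRζ : R ζ = 0 := by
    rw [← inner_self_eq_zero (𝕜 := ℝ), ← hR, show D (R ζ) = 0 from hζ, map_zero]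
  refine hB.1 ζ (hD.forall.2 fun v => ?_)
  rw [hR, hRζ, inner_zero_left]

variable {n : ℕ} {T : ℝ} {H₀ H₁ : Mat n}

theorem dEnd_mem_tangentSpace (hT : 0 ≤ T) (hH₀ : H₀ ∈ skewAdjoint (Mat n))
    (hH₁ : H₁ ∈ skewAdjoint (Mat n)) (ρ₀ : Mat n) (u v : Control T) :
    dEnd H₀ H₁ ρ₀ u v ∈ tangentSpace (endMap H₀ H₁ ρ₀ u) := by
  rw [dEnd_eq_lie hT hH₀ hH₁]
  exact lie_mem_tangentSpace _ (generator_endPropagator_mem_skewAdjoint hT hH₀ hH₁ u v)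

/-- The differential of the end-point map with values in the tangent space. -/
def tangentDEnd (hT : 0 ≤ T) (hH₀ : H₀ ∈ skewAdjoint (Mat n)) (hH₁ : H₁ ∈ skewAdjoint (Mat n))
    (ρ₀ : Mat n) (u : Control T) : Control T →L[ℝ] tangentSpace (endMap H₀ H₁ ρ₀ u) :=
  (dEnd H₀ H₁ ρ₀ u).codRestrict _ (dEnd_mem_tangentSpace hT hH₀ hH₁ ρ₀ u)

theorem surjective_tangentDEnd (hT : 0 ≤ T) (hH₀ : H₀ ∈ skewAdjoint (Mat n))
    (hH₁ : H₁ ∈ skewAdjoint (Mat n)) {ρ₀ : Mat n} {u : Control T} (hu : IsRegular H₀ H₁ ρ₀ u) :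
    Function.Surjective (tangentDEnd hT hH₀ hH₁ ρ₀ u) := by
  have hrange : LinearMap.range (dEnd H₀ H₁ ρ₀ u : Control T →ₗ[ℝ] Mat n) =
      tangentSpace (endMap H₀ H₁ ρ₀ u) := by
    refine Submodule.eq_of_le_of_finrank_eq ?_ ?_
    · exact LinearMap.range_le_iff_comap.2
        (eq_top_iff.2 fun v _ => dEnd_mem_tangentSpace hT hH₀ hH₁ ρ₀ u v)
    · rw [endMap_eq_conj_endPropagator hT hH₀ hH₁]
      exact hu.trans (finrank_tangentSpace_conj
        ⟨_, endPropagator_mem_unitary hT hH₀ hH₁ u⟩ ρ₀).symm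
  rintro ⟨ξ, hξ⟩
  obtain ⟨v, hv⟩ := hrange.ge hξ
  exact ⟨v, Subtype.ext hv⟩

theorem dEndAdj_spec (hT : 0 ≤ T) (hH₀ : H₀ ∈ skewAdjoint (Mat n))
    (hH₁ : H₁ ∈ skewAdjoint (Mat n)) {ρ₀ : Mat n} {u : Control T}
    (ζ : tangentSpace (endMap H₀ H₁ ρ₀ u)) (v : Control T) :
    metricForm _ ζ (tangentDEnd hT hH₀ hH₁ ρ₀ u v) = inner ℝ (dEndAdj H₀ H₁ ρ₀ u ζ) v := by
  let φ : Control T →L[ℝ] ℝ :=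
    (metricForm _ ζ).toContinuousLinearMap ∘L tangentDEnd hT hH₀ hH₁ ρ₀ u
  have h : ∃ w : Control T, ∀ v : Control T,
      metric (endMap H₀ H₁ ρ₀ u) ζ (dEnd H₀ H₁ ρ₀ u v) = inner ℝ w v :=
    ⟨(InnerProductSpace.toDual ℝ (Control T)).symm φ, fun v =>
      (InnerProductSpace.toDual_symm_apply (y := φ)).symm⟩
  exact Classical.epsilon_spec h v

/-- The adjoint of the differential of the end-point map as a linear map. -/
def dEndAdjLin (hT : 0 ≤ T) (hH₀ : H₀ ∈ skewAdjoint (Mat n)) (hH₁ : H₁ ∈ skewAdjoint (Mat n))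
    (ρ₀ : Mat n) (u : Control T) : tangentSpace (endMap H₀ H₁ ρ₀ u) →ₗ[ℝ] Control T where
  toFun ζ := dEndAdj H₀ H₁ ρ₀ u ζ
  map_add' ζ₁ ζ₂ := ext_inner_right ℝ fun v => by
    simp only [inner_add_left, ← dEndAdj_spec hT hH₀ hH₁, map_add, LinearMap.add_apply]
  map_smul' c ζ := ext_inner_right ℝ fun v => by
    simp only [RingHom.id_apply, real_inner_smul_left, ← dEndAdj_spec hT hH₀ hH₁, map_smul,
      LinearMap.smul_apply, smul_eq_mul]

theorem dEnd_ne_zero_of_mem_adjImage (hT : 0 ≤ T) (hH₀ : H₀ ∈ skewAdjoint (Mat n))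
    (hH₁ : H₁ ∈ skewAdjoint (Mat n)) {ρ₀ : Mat n} {u v : Control T}
    (hv : v ∈ adjImage H₀ H₁ ρ₀ u) (hv₀ : v ≠ 0) : dEnd H₀ H₁ ρ₀ u v ≠ 0 := by
  obtain ⟨ζ, hζ, rfl⟩ := hv
  intro h
  have hzero : tangentDEnd hT hH₀ hH₁ ρ₀ u (dEndAdj H₀ H₁ ρ₀ u ζ) = 0 := Subtype.ext h
  have hadj := dEndAdj_spec hT hH₀ hH₁ ⟨ζ, hζ⟩ (dEndAdj H₀ H₁ ρ₀ u ζ)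
  rw [hzero, map_zero] at hadj
  exact hv₀ (inner_self_eq_zero.1 hadj.symm)

theorem exists_mem_adjImage_dEnd_eq (hT : 0 ≤ T) (hH₀ : H₀ ∈ skewAdjoint (Mat n))
    (hH₁ : H₁ ∈ skewAdjoint (Mat n)) {ρ₀ : Mat n} {u : Control T} (hu : IsRegular H₀ H₁ ρ₀ u)
    {ξ : Mat n} (hξ : ξ ∈ tangentSpace (endMap H₀ H₁ ρ₀ u)) :
    ∃ v ∈ adjImage H₀ H₁ ρ₀ u, dEnd H₀ H₁ ρ₀ u v = ξ := by
  obtain ⟨ζ, hζ⟩ := surjective_comp_adjoint (nondegenerate_metricForm (endMap H₀ H₁ ρ₀ u))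
    (D := (tangentDEnd hT hH₀ hH₁ ρ₀ u).toLinearMap) (R := dEndAdjLin hT hH₀ hH₁ ρ₀ u)
    (surjective_tangentDEnd hT hH₀ hH₁ hu) (dEndAdj_spec hT hH₀ hH₁) ⟨ξ, hξ⟩
  exact ⟨_, mem_image_of_mem _ ζ.2, congrArg Subtype.val hζ⟩

end Adjoint

section CostHessian

variable {n : ℕ} {T : ℝ} {H₀ H₁ ρ₀ θ : Mat n} {u : Control T}

theorem contDiff_cost (hT : 0 ≤ T) {k : WithTop ℕ∞} :
    ContDiff ℝ k (cost (T := T) H₀ H₁ ρ₀ θ) :=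
  (objectiveCLM θ).contDiff.comp (contDiff_endMap hT H₀ H₁ ρ₀)

theorem fderiv_fderiv_cost (hT : 0 ≤ T) (hH₀ : H₀ ∈ skewAdjoint (Mat n))
    (hH₁ : H₁ ∈ skewAdjoint (Mat n)) (h : Commute (endMap H₀ H₁ ρ₀ u) θ) (v w : Control T) :
    fderiv ℝ (fderiv ℝ (cost (T := T) H₀ H₁ ρ₀ θ)) u v w =
      hessForm θ (endMap H₀ H₁ ρ₀ u) (dEnd H₀ H₁ ρ₀ u v) (dEnd H₀ H₁ ρ₀ u w) := by
  rw [dEnd_eq_lie hT hH₀ hH₁, dEnd_eq_lie hT hH₀ hH₁, hessForm_lie h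
    (generator_endPropagator_mem_skewAdjoint hT hH₀ hH₁ u v)
    (generator_endPropagator_mem_skewAdjoint hT hH₀ hH₁ u w)]
  exact fderiv_fderiv_objective_comp (hasFDerivAt_endMap hT hH₀ hH₁ ρ₀)
    (differentiable_unitaryGenerator (contDiff_endPropagator hT H₀ H₁) u) h v w

theorem inner_hessianA (hT : 0 ≤ T) (hH₀ : H₀ ∈ skewAdjoint (Mat n))
    (hH₁ : H₁ ∈ skewAdjoint (Mat n)) (h : Commute (endMap H₀ H₁ ρ₀ u) θ) (v w : Control T) :
    inner ℝ (hessianA H₀ H₁ ρ₀ θ u v) w =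
      hessForm θ (endMap H₀ H₁ ρ₀ u) (dEnd H₀ H₁ ρ₀ u v) (dEnd H₀ H₁ ρ₀ u w) := by
  obtain ⟨hmem, hrep⟩ := hessOp_spec h ⟨_, dEnd_mem_tangentSpace hT hH₀ hH₁ ρ₀ u v⟩
  exact (dEndAdj_spec hT hH₀ hH₁ ⟨_, hmem⟩ w).symm.trans
    (hrep _ (dEnd_mem_tangentSpace hT hH₀ hH₁ ρ₀ u w))

end CostHessian
section Orbit

theorem exists_smul_mem_specialUnitaryGroup {ι : Type*} [Fintype ι] [DecidableEq ι]
    (U : Matrix.unitaryGroup ι ℂ) :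
    ∃ c ∈ unitary ℂ, c • (U : Matrix ι ι ℂ) ∈ Matrix.specialUnitaryGroup ι ℂ := by
  suffices h : ∃ c ∈ unitary ℂ, c ^ Fintype.card ι * (U : Matrix ι ι ℂ).det = 1 by
    obtain ⟨c, hc, hdet⟩ := h
    refine ⟨c, hc, Matrix.mem_specialUnitaryGroup_iff.2 ⟨?_, by rw [Matrix.det_smul, hdet]⟩⟩
    rw [Matrix.mem_unitaryGroup_iff, star_smul, smul_mul_smul_comm,
      Unitary.mul_star_self_of_mem hc, Unitary.mul_star_self_of_mem U.2, one_smul]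
  have hU := Matrix.det_of_mem_unitary U.2
  cases isEmpty_or_nonempty ι
  · exact ⟨1, one_mem _, by rw [Matrix.det_isEmpty, one_pow, one_mul]⟩
  obtain ⟨c, hc⟩ := IsAlgClosed.exists_pow_nat_eq (star (U : Matrix ι ι ℂ).det)
    (Fintype.card_pos_iff.2 ‹Nonempty ι›)
  have hnorm : ‖c‖ = 1 := by
    rw [← pow_eq_one_iff_of_nonneg (norm_nonneg c) (Fintype.card_ne_zero (α := ι)), ← norm_pow,
      hc, norm_star, CStarRing.norm_of_mem_unitary hU]
  refine ⟨c, Unitary.mem_iff_self_mul_star.2 ?_, by rw [hc, Unitary.star_mul_self_of_mem hU]⟩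
  rw [← starRingEnd_apply, Complex.mul_conj', hnorm, Complex.ofReal_one, one_pow]

variable {n : ℕ} {ρ₀ ρ θ : Mat n}

theorem mem_orbit_iff : ρ ∈ orbit ρ₀ ↔ ∃ V : Matrix.unitaryGroup (Fin n) ℂ, conj V ρ₀ = ρ := by
  constructor
  · rintro ⟨U, hU, rfl⟩
    exact ⟨⟨U, Matrix.specialUnitaryGroup_le_unitaryGroup hU⟩, Unitary.conjStarAlgAut_apply ..⟩
  · rintro ⟨V, rfl⟩
    obtain ⟨c, hc, hcV⟩ := exists_smul_mem_specialUnitaryGroup V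
    refine ⟨_, hcV, ?_⟩
    rw [Unitary.conjStarAlgAut_apply, Matrix.conjTranspose_smul, smul_mul_assoc,
      smul_mul_smul_comm, Unitary.mul_star_self_of_mem hc, one_smul, Matrix.star_eq_conjTranspose]

theorem isHermitian_of_mem_orbit (hρ₀ : ρ₀.IsHermitian) (h : ρ ∈ orbit ρ₀) : ρ.IsHermitian := by
  obtain ⟨V, rfl⟩ := mem_orbit_iff.1 h
  rw [Matrix.IsHermitian, ← Matrix.star_eq_conjTranspose, ← map_star,
    Matrix.star_eq_conjTranspose, hρ₀.eq]

theorem mem_criticalPoints_iff (hρ₀ : ρ₀.IsHermitian) (hθ : θ.IsHermitian) :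
    ρ ∈ criticalPoints ρ₀ θ ↔ ρ ∈ orbit ρ₀ ∧ Commute ρ θ := by
  have hfderiv (ξ : Mat n) : fderiv ℝ (objective θ) ρ ξ = objective θ ξ :=
    DFunLike.congr_fun (objectiveCLM θ).hasFDerivAt.fderiv ξ
  simp only [criticalPoints, mem_ofPred_eq, hfderiv]
  refine and_congr_right fun hρ => ⟨fun h => ?_, fun h ξ hξ => ?_⟩
  · have hskew : ⁅θ, ρ⁆ ∈ skewAdjoint (Mat n) := by
      rw [skewAdjoint.mem_iff, Ring.lie_def, star_sub, star_mul, star_mul, neg_sub,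
        Matrix.star_eq_conjTranspose, Matrix.star_eq_conjTranspose, hθ.eq,
        (isHermitian_of_mem_orbit hρ₀ hρ).eq]
    have hzero : hsForm n ⁅θ, ρ⁆ ⁅θ, ρ⁆ = 0 := by
      rw [hsForm_apply, ← Matrix.star_eq_conjTranspose, skewAdjoint.mem_iff.1 hskew, neg_mul,
        Matrix.trace_neg, Complex.neg_re, ← objective, ← objective_lie,
        h _ (lie_mem_tangentSpace ρ hskew), neg_zero]
    exact (commute_iff_lie_eq.2 (hsForm_self_eq_zero.1 hzero)).symm
  · obtain ⟨Ω, -, rfl⟩ := mem_tangentSpace.1 hξ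
    exact objective_lie_eq_zero h Ω

end Orbit

section DiagonalStates

theorem exists_perm_comp_eq_of_range_eq {ι α : Type*} [Finite ι] {f g : ι → α}
    (hg : Function.Injective g) (h : range f = range g) : ∃ σ : Equiv.Perm ι, g ∘ σ = f := by
  choose σ hσ using fun i => h.le (mem_range_self i)
  choose τ hτ using fun i => h.ge (mem_range_self i)
  have hsurj : Function.Surjective σ := fun i => ⟨τ i, hg ((hσ _).trans (hτ i))⟩
  exact ⟨Equiv.ofBijective σ (Finite.surjective_iff_bijective.1 hsurj), funext hσ⟩

theorem eq_diagonal_of_commute_diagonal {ι R : Type*} [Fintype ι] [DecidableEq ι] [CommRing R]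
    [NoZeroDivisors R] {b : ι → R} (hb : Function.Injective b) {A : Matrix ι ι R}
    (h : Commute A (Matrix.diagonal b)) : A = Matrix.diagonal A.diag := by
  refine (Matrix.isDiag_iff_diagonal_diag A).1 (fun i j hij => ?_) |>.symm
  have hentry := congrFun₂ h.eq i j
  rw [Matrix.mul_diagonal, Matrix.diagonal_mul, mul_comm, ← sub_eq_zero, ← sub_mul] at hentry
  exact (mul_eq_zero.1 hentry).resolve_left (sub_ne_zero.2 (hb.ne hij.symm))

variable {n : ℕ}

theorem spectrum_conj (V : Matrix.unitaryGroup (Fin n) ℂ) (A : Mat n) :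
    spectrum ℂ (conj V A) = spectrum ℂ A :=
  AlgEquiv.spectrum_eq (Unitary.conjStarAlgAut ℂ (Mat n) V) A

theorem exists_conj_diagonal_eq_comp_perm (σ : Equiv.Perm (Fin n)) :
    ∃ P : Matrix.unitaryGroup (Fin n) ℂ,
      ∀ d : Fin n → ℂ, conj P (Matrix.diagonal d) = Matrix.diagonal (d ∘ σ) := by
  have hstar : star (σ.permMatrix ℂ) = σ⁻¹.permMatrix ℂ := Matrix.conjTranspose_permMatrix σ
  refine ⟨⟨σ.permMatrix ℂ, Matrix.mem_unitaryGroup_iff.2 ?_⟩, fun d => ?_⟩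
  · rw [hstar, ← Matrix.permMatrix_mul, inv_mul_cancel, Matrix.permMatrix_one]
  · calc σ.permMatrix ℂ * Matrix.diagonal d * star (σ.permMatrix ℂ)
        = (Matrix.diagonal d).submatrix σ σ := by
          rw [hstar, PEquiv.toMatrix_toPEquiv_mul, PEquiv.mul_toMatrix_toPEquiv]
          rfl
      _ = Matrix.diagonal (d ∘ σ) := Matrix.submatrix_diagonal_equiv d σ

/-- The state with populations `a` in the orthonormal basis formed by the columns of `V`. -/
def diagState (V : Matrix.unitaryGroup (Fin n) ℂ) (a : Fin n → ℝ) : Mat n :=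
  conj V (Matrix.diagonal fun i => (a i : ℂ))

theorem exists_diagState_eigenvalues {A : Mat n} (hA : A.IsHermitian) :
    ∃ V, diagState V hA.eigenvalues = A :=
  ⟨hA.eigenvectorUnitary, hA.spectral_theorem.symm⟩

variable (V W : Matrix.unitaryGroup (Fin n) ℂ) (a b : Fin n → ℝ)

theorem injective_diagState : Function.Injective (diagState V) := fun _ _ h =>
  funext fun i => Complex.ofReal_injective
    (congrFun (Matrix.diagonal_injective ((conj V).injective h)) i)

theorem commute_diagState : Commute (diagState V a) (diagState V b) :=
  (Matrix.commute_diagonal _ _).map (conj V)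

theorem objective_diagState : objective (diagState V b) (diagState V a) = ∑ i, a i * b i := by
  rw [diagState, diagState, objective_conj, objective, Matrix.diagonal_mul_diagonal,
    Matrix.trace_diagonal, Complex.re_sum]
  exact Finset.sum_congr rfl fun i _ => Complex.re_ofReal_mul _ _

theorem diagState_comp_perm_mem_orbit (σ : Equiv.Perm (Fin n)) :
    diagState V (a ∘ σ) ∈ orbit (diagState W a) := by
  obtain ⟨P, hP⟩ := exists_conj_diagonal_eq_comp_perm σ
  refine mem_orbit_iff.2 ⟨V * P * W⁻¹, ?_⟩
  calc conj (V * P * W⁻¹) (diagState W a)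
      = conj (V * P * W⁻¹ * W) (Matrix.diagonal fun i => (a i : ℂ)) :=
        (Unitary.conjStarAlgAut_mul_apply _ _ _).symm
    _ = conj V (conj P (Matrix.diagonal fun i => (a i : ℂ))) := by
        rw [inv_mul_cancel_right, Unitary.conjStarAlgAut_mul_apply]
    _ = diagState V (a ∘ σ) := congrArg (conj V) (hP _)

variable {V W a b}

theorem exists_perm_diagState_eq (ha : Function.Injective a) (hb : Function.Injective b)
    {ρ : Mat n} (hρ : ρ ∈ orbit (diagState W a)) (h : Commute ρ (diagState V b)) :
    ∃ σ : Equiv.Perm (Fin n), diagState V (a ∘ σ) = ρ := by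
  obtain ⟨A, rfl⟩ : ∃ A, conj V A = ρ := (conj V).surjective ρ
  have hA : A = Matrix.diagonal A.diag :=
    eq_diagonal_of_commute_diagonal (Complex.ofReal_injective.comp hb)
      (Commute.of_map (conj V).injective h)
  have hspec : spectrum ℂ (conj V A) = range fun i => (a i : ℂ) := by
    obtain ⟨U, hU⟩ := mem_orbit_iff.1 hρ
    rw [← hU, spectrum_conj, diagState, spectrum_conj, spectrum_diagonal]
  rw [spectrum_conj, hA, spectrum_diagonal] at hspec
  obtain ⟨σ, hσ⟩ := exists_perm_comp_eq_of_range_eq (Complex.ofReal_injective.comp ha) hspec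
  refine ⟨σ, ?_⟩
  rw [hA, ← hσ]
  rfl

theorem criticalPoints_diagState (ha : Function.Injective a) (hb : Function.Injective b)
    (hρ₀ : (diagState W a).IsHermitian) (hθ : (diagState V b).IsHermitian) :
    criticalPoints (diagState W a) (diagState V b) =
      range fun σ : Equiv.Perm (Fin n) => diagState V (a ∘ σ) := by
  ext ρ
  rw [mem_criticalPoints_iff hρ₀ hθ]
  constructor
  · rintro ⟨hρ, hcomm⟩
    exact exists_perm_diagState_eq ha hb hρ hcomm
  · rintro ⟨σ, rfl⟩
    exact ⟨diagState_comp_perm_mem_orbit V W a σ, commute_diagState V _ _⟩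

theorem injective_diagState_comp_perm (V : Matrix.unitaryGroup (Fin n) ℂ)
    (ha : Function.Injective a) :
    Function.Injective fun σ : Equiv.Perm (Fin n) => diagState V (a ∘ σ) :=
  fun _ _ h => Equiv.ext fun i => ha (congrFun (injective_diagState V h) i)

end DiagonalStates
section Rearrangement

variable {n : ℕ}

theorem eq_of_antivary_comp {α β : Type*} [PartialOrder α] [LinearOrder β] {a : Fin n → α}
    {b : Fin n → β} (ha : Function.Injective a) (hb : Function.Injective b)
    {σ τ : Equiv.Perm (Fin n)} (hσ : Antivary (a ∘ σ) b) (hτ : Antivary (a ∘ τ) b) : σ = τ := by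
  have hsort : StrictMono (b ∘ Tuple.sort b) :=
    (Tuple.monotone_sort b).strictMono_of_injective (hb.comp (Tuple.sort b).injective)
  have hanti {π : Equiv.Perm (Fin n)} (hπ : Antivary (a ∘ π) b) :
      Antitone (a ∘ (π * Tuple.sort b)) :=
    antitone_iff_forall_lt.2 fun _ _ hij => hπ (hsort hij)
  have hcomp := ha.comp_left (Tuple.unique_antitone (hanti hσ) (hanti hτ))
  exact mul_right_cancel (DFunLike.coe_injective hcomp)

theorem exists_antivary_comp {α β : Type*} [LinearOrder α] [LinearOrder β] (a : Fin n → α)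
    (b : Fin n → β) : ∃ σ : Equiv.Perm (Fin n), Antivary (a ∘ σ) b := by
  have hsort : Antivary (a ∘ Tuple.sort a ∘ Fin.rev) (b ∘ Tuple.sort b) :=
    ((Tuple.monotone_sort a).comp_antitone Fin.rev_anti).antivary (Tuple.monotone_sort b)
  refine ⟨Tuple.sort a * Fin.revPerm * (Tuple.sort b)⁻¹, ?_⟩
  have hb : (b ∘ Tuple.sort b) ∘ (Tuple.sort b).symm = b := by
    rw [Function.comp_assoc, Equiv.self_comp_symm, Function.comp_id]
  have h := hsort.comp_right (Tuple.sort b).symm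
  rw [hb] at h
  exact h

variable {a b : Fin n → ℝ}

theorem antivary_comp_iff_forall_sum_le {σ : Equiv.Perm (Fin n)} :
    Antivary (a ∘ σ) b ↔ ∀ τ : Equiv.Perm (Fin n), ∑ i, a (σ i) * b i ≤ ∑ i, a (τ i) * b i := by
  have hle {σ : Equiv.Perm (Fin n)} (hσ : Antivary (a ∘ σ) b) (τ : Equiv.Perm (Fin n)) :
      ∑ i, a (σ i) * b i ≤ ∑ i, a (τ i) * b i := by
    simpa using hσ.sum_mul_le_sum_comp_perm_mul (σ := σ⁻¹ * τ)
  refine ⟨hle, fun h => ?_⟩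
  obtain ⟨τ, hτ⟩ := exists_antivary_comp a b
  have hsum : ∑ i, a (σ i) * b i = ∑ i, a (τ i) * b i := (h τ).antisymm (hle hτ σ)
  have hσ := (hτ.sum_comp_perm_mul_eq_sum_mul_iff (σ := τ⁻¹ * σ)).1 (by simpa using hsum)
  simpa [Function.comp_assoc, ← Equiv.Perm.coe_mul] using hσ

variable {κ : Type*} [LinearOrder κ] {s : κ ≃ Equiv.Perm (Fin n)}

theorem isMin_iff_antivary (ha : Function.Injective a) (hb : Function.Injective b)
    (hs : Monotone fun k => ∑ i, a (s k i) * b i) {k : κ} :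
    IsMin k ↔ Antivary (a ∘ s k) b := by
  constructor
  · intro hk
    refine antivary_comp_iff_forall_sum_le.2 (s.surjective.forall.2 fun l => ?_)
    exact hs (hk.isBot l)
  · intro hk l hl
    have hl' : Antivary (a ∘ s l) b := antivary_comp_iff_forall_sum_le.2 fun τ =>
      (hs hl).trans (antivary_comp_iff_forall_sum_le.1 hk τ)
    exact (s.injective (eq_of_antivary_comp ha hb hk hl')).le

theorem isMax_iff_monovary (ha : Function.Injective a) (hb : Function.Injective b)
    (hs : Monotone fun k => ∑ i, a (s k i) * b i) {k : κ} :
    IsMax k ↔ Monovary (a ∘ s k) b := by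
  have hb' : Function.Injective (-b) := neg_injective.comp hb
  have hneg : Monotone fun k : κᵒᵈ => ∑ i, a ((OrderDual.ofDual.trans s) k i) * (-b) i :=
    fun k l h => by
      simp only [Pi.neg_apply, mul_neg, Finset.sum_neg_distrib]
      exact neg_le_neg (hs h)
  rw [← isMin_toDual_iff, isMin_iff_antivary ha hb' hneg, antivary_neg_right]
  rfl

end Rearrangement
section HessianSigns

theorem lie_diagonal_apply {ι R : Type*} [Fintype ι] [DecidableEq ι] [CommRing R]
    (a : ι → R) (L : Matrix ι ι R) (i j : ι) :
    ⁅Matrix.diagonal a, L⁆ i j = (a i - a j) * L i j := by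
  rw [Ring.lie_def, Matrix.sub_apply, Matrix.diagonal_mul, Matrix.mul_diagonal, sub_mul,
    mul_comm (L i j)]

theorem single_sub_single_mem_skewAdjoint {ι R : Type*} [DecidableEq ι] [Ring R] [StarRing R]
    (i j : ι) :
    Matrix.single i j (1 : R) - Matrix.single j i 1 ∈ skewAdjoint (Matrix ι ι R) := by
  rw [skewAdjoint.mem_iff, Matrix.star_eq_conjTranspose, Matrix.conjTranspose_sub,
    Matrix.conjTranspose_single, Matrix.conjTranspose_single, star_one, neg_sub]

variable {n : ℕ} {V : Matrix.unitaryGroup (Fin n) ℂ} {a b : Fin n → ℝ}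

theorem conj_mem_skewAdjoint (V : Matrix.unitaryGroup (Fin n) ℂ) {L : Mat n}
    (hL : L ∈ skewAdjoint (Mat n)) : conj V L ∈ skewAdjoint (Mat n) := by
  rw [skewAdjoint.mem_iff, ← map_star, skewAdjoint.mem_iff.1 hL, map_neg]

theorem exists_lie_conj_eq_of_mem_tangentSpace {ξ : Mat n}
    (hξ : ξ ∈ tangentSpace (diagState V a)) :
    ∃ L ∈ skewAdjoint (Mat n), ⁅diagState V a, conj V L⁆ = ξ := by
  obtain ⟨Ω, hΩ, rfl⟩ := mem_tangentSpace.1 hξ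
  obtain ⟨L, rfl⟩ : ∃ L, conj V L = Ω := (conj V).surjective Ω
  exact ⟨L, ((conj_mem_su_iff V).1 hΩ).1, rfl⟩

variable (V a b) in
theorem hessForm_lie_conj {L : Mat n} (hL : L ∈ skewAdjoint (Mat n)) :
    hessForm (diagState V b) (diagState V a) ⁅diagState V a, conj V L⁆ ⁅diagState V a, conj V L⁆ =
      objective ⁅Matrix.diagonal fun i => (b i : ℂ), ⁅Matrix.diagonal fun i => (a i : ℂ), L⁆⁆
        L := by
  rw [hessForm_lie (commute_diagState V a b) (conj_mem_skewAdjoint V hL)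
    (conj_mem_skewAdjoint V hL), diagState, diagState, secondVariation_conj,
    secondVariation_apply, objective_lie]

variable (V a b) in
theorem hessForm_lie_conj_eq_sum {L : Mat n} (hL : L ∈ skewAdjoint (Mat n)) :
    hessForm (diagState V b) (diagState V a) ⁅diagState V a, conj V L⁆ ⁅diagState V a, conj V L⁆ =
      -∑ i, ∑ j, (a i - a j) * (b i - b j) * Complex.normSq (L i j) := by
  have hnormSq (i j : Fin n) : L i j * L j i = -(Complex.normSq (L i j) : ℂ) := by
    rw [← Complex.mul_conj, starRingEnd_apply, ← Matrix.star_apply, skewAdjoint.mem_iff.1 hL,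
      Matrix.neg_apply, mul_neg, neg_neg]
  have hterm (i j : Fin n) :
      L i j * ⁅Matrix.diagonal fun i => (b i : ℂ), ⁅Matrix.diagonal fun i => (a i : ℂ), L⁆⁆ j i =
        ((-((a i - a j) * (b i - b j) * Complex.normSq (L i j)) : ℝ) : ℂ) := by
    rw [lie_diagonal_apply, lie_diagonal_apply]
    push_cast
    linear_combination ((b j : ℂ) - b i) * (a j - a i) * hnormSq i j
  rw [hessForm_lie_conj V a b hL, objective, Matrix.trace]
  simp only [Matrix.diag_apply, Matrix.mul_apply, hterm, ← Complex.ofReal_sum, Complex.ofReal_re,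
    Finset.sum_neg_distrib]

theorem hessForm_pos_of_antivary (hb : Function.Injective b) (h : Antivary a b) {ξ : Mat n}
    (hξ : ξ ∈ tangentSpace (diagState V a)) (hξ₀ : ξ ≠ 0) :
    0 < hessForm (diagState V b) (diagState V a) ξ ξ := by
  obtain ⟨L, hL, rfl⟩ := exists_lie_conj_eq_of_mem_tangentSpace hξ
  obtain ⟨i, j, hij⟩ : ∃ i j, ((a i : ℂ) - a j) * L i j ≠ 0 := by
    by_contra! hzero
    have hlie : ⁅Matrix.diagonal fun i => (a i : ℂ), L⁆ = 0 :=
      Matrix.ext fun i j => (lie_diagonal_apply _ L i j).trans (hzero i j)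
    exact hξ₀ (by rw [diagState, ← map_ring_lie, hlie, map_zero])
  have haij : a i - a j ≠ 0 := by exact_mod_cast left_ne_zero_of_mul hij
  have hbij : b i - b j ≠ 0 := sub_ne_zero.2 (hb.ne (by rintro rfl; exact haij (sub_self _)))
  have hnonpos (k l : Fin n) : (a k - a l) * (b k - b l) ≤ 0 :=
    antivary_iff_forall_mul_nonpos.1 h l k
  have hterm (k l : Fin n) : 0 ≤ -((a k - a l) * (b k - b l) * Complex.normSq (L k l)) :=
    neg_nonneg.2 (mul_nonpos_of_nonpos_of_nonneg (hnonpos k l) (Complex.normSq_nonneg _))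
  refine lt_of_lt_of_eq ?_ (hessForm_lie_conj_eq_sum V a b hL).symm
  simp only [← Finset.sum_neg_distrib]
  refine Finset.sum_pos' (fun k _ => Finset.sum_nonneg fun l _ => hterm k l)
    ⟨i, Finset.mem_univ i, Finset.sum_pos' (fun l _ => hterm i l) ⟨j, Finset.mem_univ j, ?_⟩⟩
  exact neg_pos.2 (mul_neg_of_neg_of_pos ((hnonpos i j).lt_of_ne (mul_ne_zero haij hbij))
    (Complex.normSq_pos.2 (right_ne_zero_of_mul hij)))

theorem hessForm_neg_of_monovary (hb : Function.Injective b) (h : Monovary a b) {ξ : Mat n}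
    (hξ : ξ ∈ tangentSpace (diagState V a)) (hξ₀ : ξ ≠ 0) :
    hessForm (diagState V b) (diagState V a) ξ ξ < 0 := by
  have hb' : Function.Injective (-b) := neg_injective.comp hb
  have hpos := hessForm_pos_of_antivary hb' (antivary_neg_right.2 h) hξ hξ₀
  obtain ⟨L, hL, rfl⟩ := exists_lie_conj_eq_of_mem_tangentSpace hξ
  rw [← neg_pos]
  refine hpos.trans_eq ?_
  rw [hessForm_lie_conj_eq_sum V a (-b) hL, hessForm_lie_conj_eq_sum V a b hL]
  simp only [Pi.neg_apply, neg_sub_neg, ← Finset.sum_neg_distrib]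
  refine Finset.sum_congr rfl fun i _ => Finset.sum_congr rfl fun j _ => ?_
  ring

theorem exists_hessForm_eq (V : Matrix.unitaryGroup (Fin n) ℂ) (a b : Fin n → ℝ)
    (i j : Fin n) :
    ∃ ξ ∈ tangentSpace (diagState V a),
      hessForm (diagState V b) (diagState V a) ξ ξ = -2 * ((a i - a j) * (b i - b j)) := by
  let L : Mat n := Matrix.single i j 1 - Matrix.single j i 1
  have hL : L ∈ skewAdjoint (Mat n) := single_sub_single_mem_skewAdjoint i j
  refine ⟨_, lie_mem_tangentSpace _ (conj_mem_skewAdjoint V hL), ?_⟩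
  rw [hessForm_lie_conj V a b hL, objective, sub_mul, Matrix.trace_sub, Matrix.trace_single_mul,
    Matrix.trace_single_mul]
  simp only [lie_diagonal_apply]
  obtain rfl | hij := eq_or_ne i j
  · simp
  · have hLij : L i j = 1 := by simp [L, hij]
    have hLji : L j i = -1 := by simp [L, hij, hij.symm]
    rw [hLij, hLji, ← Complex.ofReal_re (-2 * _)]
    push_cast
    ring_nf

theorem exists_hessForm_neg_of_not_antivary (V : Matrix.unitaryGroup (Fin n) ℂ)
    (h : ¬Antivary a b) :
    ∃ ξ ∈ tangentSpace (diagState V a), hessForm (diagState V b) (diagState V a) ξ ξ < 0 := by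
  simp only [antivary_iff_forall_mul_nonpos, not_forall, not_le] at h
  obtain ⟨j, i, hij⟩ := h
  obtain ⟨ξ, hξ, heq⟩ := exists_hessForm_eq V a b i j
  exact ⟨ξ, hξ, by linarith⟩

theorem exists_hessForm_pos_of_not_monovary (V : Matrix.unitaryGroup (Fin n) ℂ)
    (h : ¬Monovary a b) :
    ∃ ξ ∈ tangentSpace (diagState V a), 0 < hessForm (diagState V b) (diagState V a) ξ ξ := by
  simp only [monovary_iff_forall_mul_nonneg, not_forall, not_le] at h
  obtain ⟨j, i, hij⟩ := h
  obtain ⟨ξ, hξ, heq⟩ := exists_hessForm_eq V a b i j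
  exact ⟨ξ, hξ, by linarith⟩

end HessianSigns
section HessianAtControl

variable {n : ℕ} {T : ℝ} {H₀ H₁ ρ₀ θ : Mat n} {u : Control T} {a b : Fin n → ℝ}
  {V : Matrix.unitaryGroup (Fin n) ℂ}

theorem inner_hessianA_self (hT : 0 ≤ T) (hH₀ : H₀ ∈ skewAdjoint (Mat n))
    (hH₁ : H₁ ∈ skewAdjoint (Mat n)) (hu : endMap H₀ H₁ ρ₀ u = diagState V a) (v : Control T) :
    inner ℝ v (hessianA H₀ H₁ ρ₀ (diagState V b) u v) =
      hessForm (diagState V b) (diagState V a) (dEnd H₀ H₁ ρ₀ u v) (dEnd H₀ H₁ ρ₀ u v) := by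
  rw [real_inner_comm, inner_hessianA hT hH₀ hH₁ (hu ▸ commute_diagState V a b), hu]

theorem inner_hessianA_self_pos (hT : 0 ≤ T) (hH₀ : H₀ ∈ skewAdjoint (Mat n))
    (hH₁ : H₁ ∈ skewAdjoint (Mat n)) (hu : endMap H₀ H₁ ρ₀ u = diagState V a)
    (hb : Function.Injective b) (h : Antivary a b) {v : Control T}
    (hv : v ∈ adjImage H₀ H₁ ρ₀ u) (hv₀ : v ≠ 0) :
    0 < inner ℝ v (hessianA H₀ H₁ ρ₀ (diagState V b) u v) := by
  rw [inner_hessianA_self hT hH₀ hH₁ hu]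
  exact hessForm_pos_of_antivary hb h (hu ▸ dEnd_mem_tangentSpace hT hH₀ hH₁ ρ₀ u v)
    (dEnd_ne_zero_of_mem_adjImage hT hH₀ hH₁ hv hv₀)

theorem inner_hessianA_self_neg (hT : 0 ≤ T) (hH₀ : H₀ ∈ skewAdjoint (Mat n))
    (hH₁ : H₁ ∈ skewAdjoint (Mat n)) (hu : endMap H₀ H₁ ρ₀ u = diagState V a)
    (hb : Function.Injective b) (h : Monovary a b) {v : Control T}
    (hv : v ∈ adjImage H₀ H₁ ρ₀ u) (hv₀ : v ≠ 0) :
    inner ℝ v (hessianA H₀ H₁ ρ₀ (diagState V b) u v) < 0 := by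
  rw [inner_hessianA_self hT hH₀ hH₁ hu]
  exact hessForm_neg_of_monovary hb h (hu ▸ dEnd_mem_tangentSpace hT hH₀ hH₁ ρ₀ u v)
    (dEnd_ne_zero_of_mem_adjImage hT hH₀ hH₁ hv hv₀)

theorem exists_inner_hessianA_self_pos (hT : 0 ≤ T) (hH₀ : H₀ ∈ skewAdjoint (Mat n))
    (hH₁ : H₁ ∈ skewAdjoint (Mat n)) (hu : endMap H₀ H₁ ρ₀ u = diagState V a)
    (hreg : IsRegular H₀ H₁ ρ₀ u) (h : ¬Monovary a b) :
    ∃ v ∈ adjImage H₀ H₁ ρ₀ u, 0 < inner ℝ v (hessianA H₀ H₁ ρ₀ (diagState V b) u v) := by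
  obtain ⟨ξ, hξ, hpos⟩ := exists_hessForm_pos_of_not_monovary V h
  obtain ⟨v, hv, rfl⟩ := exists_mem_adjImage_dEnd_eq hT hH₀ hH₁ hreg (hu ▸ hξ)
  exact ⟨v, hv, (inner_hessianA_self hT hH₀ hH₁ hu v).symm ▸ hpos⟩

theorem exists_inner_hessianA_self_neg (hT : 0 ≤ T) (hH₀ : H₀ ∈ skewAdjoint (Mat n))
    (hH₁ : H₁ ∈ skewAdjoint (Mat n)) (hu : endMap H₀ H₁ ρ₀ u = diagState V a)
    (hreg : IsRegular H₀ H₁ ρ₀ u) (h : ¬Antivary a b) :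
    ∃ v ∈ adjImage H₀ H₁ ρ₀ u, inner ℝ v (hessianA H₀ H₁ ρ₀ (diagState V b) u v) < 0 := by
  obtain ⟨ξ, hξ, hneg⟩ := exists_hessForm_neg_of_not_antivary V h
  obtain ⟨v, hv, rfl⟩ := exists_mem_adjImage_dEnd_eq hT hH₀ hH₁ hreg (hu ▸ hξ)
  exact ⟨v, hv, (inner_hessianA_self hT hH₀ hH₁ hu v).symm ▸ hneg⟩

end HessianAtControl

section Enumeration

theorem isMin_iff_val_eq_zero {N : ℕ} {i : Fin N} : IsMin i ↔ (i : ℕ) = 0 :=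
  ⟨fun h => Nat.le_zero.1 (h.isBot ⟨0, i.pos⟩), fun h _ _ => Fin.le_def.2 (h ▸ Nat.zero_le _)⟩

theorem isMax_iff_val_add_one_eq {N : ℕ} {i : Fin N} : IsMax i ↔ (i : ℕ) + 1 = N := by
  refine ⟨fun h => ?_, fun h j _ => Fin.le_def.2 (by lia)⟩
  have hlast := Fin.le_def.1 (h.isTop ⟨N - 1, Nat.sub_one_lt_of_lt i.pos⟩)
  lia

theorem exists_equiv_of_range_eq {ι κ α : Type*} {c : κ → α} {f : ι → α}
    (hc : Function.Injective c) (hf : Function.Injective f) (h : range c = range f) :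
    ∃ s : κ ≃ ι, ∀ k, f (s k) = c k :=
  ⟨(Equiv.ofInjective c hc).trans ((Equiv.setCongr h).trans (Equiv.ofInjective f hf).symm),
    fun _ => Equiv.apply_ofInjective_symm hf _⟩

theorem exists_criticalPoints_eq_range {n : ℕ} {ρ₀ θ : Mat n} (hρ₀ : ρ₀.IsHermitian)
    (hθ : θ.IsHermitian) (simple_ρ₀ : Function.Injective hρ₀.eigenvalues)
    (simple_θ : Function.Injective hθ.eigenvalues) :
    ∃ V a b, Function.Injective a ∧ Function.Injective b ∧ diagState V b = θ ∧
      criticalPoints ρ₀ θ = range fun σ : Equiv.Perm (Fin n) => diagState V (a ∘ σ) := by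
  obtain ⟨W, hW⟩ := exists_diagState_eigenvalues hρ₀
  obtain ⟨V, hV⟩ := exists_diagState_eigenvalues hθ
  refine ⟨V, _, _, simple_ρ₀, simple_θ, hV, ?_⟩
  have h := criticalPoints_diagState (V := V) (W := W) simple_ρ₀ simple_θ (hW.symm ▸ hρ₀)
    (hV.symm ▸ hθ)
  rwa [hW, hV] at h

end Enumeration

end QControl

end

open QControl in
theorem mainTheorem9_general (n : ℕ) (T : ℝ) (hT : 0 ≤ T) (H₀ H₁ ρ₀ θ : Mat n)
    (hH₀ : H₀ ∈ skewAdjoint (Mat n)) (hH₁ : H₁ ∈ skewAdjoint (Mat n))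
    (hρ₀ : ρ₀.IsHermitian) (hθ : θ.IsHermitian)
    (simple_ρ₀ : Function.Injective hρ₀.eigenvalues)
    (simple_θ : Function.Injective hθ.eigenvalues) :
    (criticalPoints ρ₀ θ).ncard = n.factorial ∧
    ∀ c : Fin n.factorial → Mat n,
      Function.Injective c → Set.range c = criticalPoints ρ₀ θ →
      Monotone (fun i => objective θ (c i)) →
      ∀ (i : Fin n.factorial) (u : Control T), endMap H₀ H₁ ρ₀ u = c i →
        (ContDiff ℝ 2 (cost (T := T) H₀ H₁ ρ₀ θ) ∧
          ∀ v w : Control T,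
            fderiv ℝ (fderiv ℝ (cost (T := T) H₀ H₁ ρ₀ θ)) u v w =
              inner ℝ (hessianA H₀ H₁ ρ₀ θ u v) w) ∧
        ((i : ℕ) = 0 → ∀ v ∈ adjImage H₀ H₁ ρ₀ u, v ≠ 0 →
          0 < inner ℝ v (hessianA H₀ H₁ ρ₀ θ u v)) ∧
        ((i : ℕ) + 1 = n.factorial → ∀ v ∈ adjImage H₀ H₁ ρ₀ u, v ≠ 0 →
          inner ℝ v (hessianA H₀ H₁ ρ₀ θ u v) < 0) ∧
        (IsRegular H₀ H₁ ρ₀ u → 0 < (i : ℕ) → (i : ℕ) + 1 < n.factorial →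
          (∃ v ∈ adjImage H₀ H₁ ρ₀ u,
            0 < inner ℝ v (hessianA H₀ H₁ ρ₀ θ u v)) ∧
          ∃ v ∈ adjImage H₀ H₁ ρ₀ u,
            inner ℝ v (hessianA H₀ H₁ ρ₀ θ u v) < 0) := by
  obtain ⟨V, a, b, ha, hb, rfl, hcrit⟩ :=
    exists_criticalPoints_eq_range hρ₀ hθ simple_ρ₀ simple_θ
  have hinj := injective_diagState_comp_perm V ha
  refine ⟨?_, fun c hc hrange hmono i u hu => ?_⟩
  · rw [hcrit, Set.ncard_range_of_injective hinj, Nat.card_perm, Nat.card_fin]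
  obtain ⟨s, hs⟩ := exists_equiv_of_range_eq hc hinj (hrange.trans hcrit)
  have hs_mono : Monotone fun k => ∑ j, a (s k j) * b j := by
    simpa only [← hs, objective_diagState, Function.comp_apply] using hmono
  have hmin := (isMin_iff_antivary ha hb hs_mono (k := i)).symm.trans
    isMin_iff_val_eq_zero
  have hmax := (isMax_iff_monovary ha hb hs_mono (k := i)).symm.trans
    isMax_iff_val_add_one_eq
  have hend : endMap H₀ H₁ ρ₀ u = diagState V (a ∘ s i) := hu.trans (hs i).symm
  have hcomm : Commute (endMap H₀ H₁ ρ₀ u) (diagState V b) :=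
    hend ▸ commute_diagState V _ b
  refine ⟨⟨contDiff_cost hT, fun v w => ?_⟩, fun hi v => ?_, fun hi v => ?_,
    fun hreg hi₀ hiN => ⟨?_, ?_⟩⟩
  · rw [fderiv_fderiv_cost hT hH₀ hH₁ hcomm, inner_hessianA hT hH₀ hH₁ hcomm]
  · exact inner_hessianA_self_pos hT hH₀ hH₁ hend hb (hmin.2 hi)
  · exact inner_hessianA_self_neg hT hH₀ hH₁ hend hb (hmax.2 hi)
  · exact exists_inner_hessianA_self_pos hT hH₀ hH₁ hend hreg fun h =>
      hiN.ne (hmax.1 h)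
  · exact exists_inner_hessianA_self_neg hT hH₀ hH₁ hend hreg fun h =>
      hi₀.ne' (hmin.1 h)

theorem mainTheorem9 (n : ℕ) (T : ℝ) (hT : 0 < T)
    (H₀ H₁ ρ₀ θ : QControl.Mat n) (hH₀ : H₀ ∈ QControl.su n) (hH₁ : H₁ ∈ QControl.su n)
    (hρ₀ : ρ₀.IsHermitian) (hθ : θ.IsHermitian)
    (simple_ρ₀ : Function.Injective hρ₀.eigenvalues)
    (simple_θ : Function.Injective hθ.eigenvalues)
    (regular : ∀ u : QControl.Control T, QControl.IsRegular H₀ H₁ ρ₀ u) :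
    (QControl.criticalPoints ρ₀ θ).ncard = n.factorial ∧
    ∀ c : Fin n.factorial → QControl.Mat n,
      Function.Injective c → Set.range c = QControl.criticalPoints ρ₀ θ →
      Monotone (fun i => QControl.objective θ (c i)) →
      ∀ (i : Fin n.factorial) (u : QControl.Control T), QControl.endMap H₀ H₁ ρ₀ u = c i →
        (ContDiff ℝ 2 (QControl.cost (T := T) H₀ H₁ ρ₀ θ) ∧
          ∀ v w : QControl.Control T,
            fderiv ℝ (fderiv ℝ (QControl.cost (T := T) H₀ H₁ ρ₀ θ)) u v w =
              inner ℝ (QControl.hessianA H₀ H₁ ρ₀ θ u v) w) ∧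
        ((i : ℕ) = 0 → ∀ v ∈ QControl.adjImage H₀ H₁ ρ₀ u, v ≠ 0 →
          0 < inner ℝ v (QControl.hessianA H₀ H₁ ρ₀ θ u v)) ∧
        ((i : ℕ) + 1 = n.factorial → ∀ v ∈ QControl.adjImage H₀ H₁ ρ₀ u, v ≠ 0 →
          inner ℝ v (QControl.hessianA H₀ H₁ ρ₀ θ u v) < 0) ∧
        (0 < (i : ℕ) → (i : ℕ) + 1 < n.factorial →
          (∃ v ∈ QControl.adjImage H₀ H₁ ρ₀ u,
            0 < inner ℝ v (QControl.hessianA H₀ H₁ ρ₀ θ u v)) ∧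
          ∃ v ∈ QControl.adjImage H₀ H₁ ρ₀ u,
            inner ℝ v (QControl.hessianA H₀ H₁ ρ₀ θ u v) < 0) := by
  obtain ⟨hcard, h⟩ := mainTheorem9_general n T hT.le H₀ H₁ ρ₀ θ hH₀.1 hH₁.1 hρ₀ hθ simple_ρ₀
    simple_θ
  exact ⟨hcard, fun c hc hrange hmono i u hu =>
    (h c hc hrange hmono i u hu).imp_right (And.imp_right (And.imp_right fun h => h (regular u)))⟩
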